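/- **Setting.** Let $p$ (prior) and $q$ (proposal) be probability densities on a parameter space $\Theta$ with respect to a reference measure $\mathrm d\theta$. For each $\theta\in\Theta$ let $\mathbb P_\theta$ be the law of a datapoint $y$ simulated from the model with parameter $\theta$. Fix the observed data $y^\star$, a nonnegative measurable discrepancy $\delta$, a threshold $\epsilon$, and integers $M\ge 1$, $b\ge 2$, $d$, $t\ge 0$. Let $\Gamma$ be a measurable function such that $\Gamma(U)$ has density $q$ when $U\sim\mathcal U([0,1]^d)$. Put $$f(\theta)=\frac{p(\theta)}{q(\theta)}\,\mathbb P_\theta\big(\delta(y,y^\star)\le\epsilon\big),$$ and assume that $f\circ\Gamma\in L^2([0,1]^d)$. **Nets.** A $b$-ary box is a set $\prod_{j=1}^d [c_jb^{-k_j},(c_j+1)b^{-k_j})$ with integers $k_j\ge0$ and $0\le c_j<b^{k_j}$. For integers $1\le\lambda<b$ and $0\le t\le m$, a $(\lambda,t,m,d)$-net in base $b$ is a sequence of $\lambda b^m$ points of $[0,1)^d$ such that every $b$-ary box of volume $b^{t-m}$ contains exactly $\lambda b^t$ of the points and no $b$-ary box of volume $b^{t-m-1}$ contains more than $b^t$ of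 them. A scrambled $(\lambda,t,m,d)$-net is the random sequence obtained from a deterministic $(\lambda,t,m,d)$-net by nested uniform (Owen) scrambling: in each coordinate $j$, the $k$-th base-$b$ digit $a_k$ of a point is replaced by $\pi_{j;a_1\cdots a_{k-1}}(a_k)$, where the $\pi_{j;a_1\cdots a_{k-1}}$, one for each coordinate and each finite digit string, are independent, uniformly distributed permutations of $\{0,\dots,b-1\}$, the same for all points. **Sampling.** For $N=\lambda b^m$, let $\mathbf u_{1:N}$ be a scrambled $(\lambda,t,m,d)$-net in base $b$ and let $\theta_n=\Gamma(\mathbf u_n)$. Given $\theta_{1:N}$, let $y_{n,i}$ ($1\le n\le N$, $1\le i\le M$) be independent with $y_{n,i}\sim\mathbb P_{\theta_n}$, and put $$\hat Z_N=\frac1N\sum_{n=1}^N\frac{p(\theta_n)}{q(\theta_n)}\Big[\frac1M\sum_{i=1}^M\mathbf 1\{\delta(y_{n,i},y^\star)\le\epsilon\}\Big].$$ **Claim.** $\hat Z_N$ is integrable, $\mathbb E\{\hat Z_N\mid\theta_{1:N}\}$ is square integrable, and $$\operatorname{Var}\big[\mathbb E\{\hat Z_N\mid\theta_{1:N}\}\big]=o(N^{-1})$$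 as $N=\lambda b^m\to\infty$, with $b,t,d$ fixed, along any sequence of scrambled $(\lambda,t,m,d)$-nets in base $b$; here $\lambda$, $m$ and the underlying deterministic net may vary with $N$. -/

import Mathlib

open MeasureTheory ProbabilityTheory

namespace RQMC

/-- The `b`-ary box (elementary interval)
`∏ⱼ [cⱼ / b ^ kⱼ, (cⱼ + 1) / b ^ kⱼ)` in dimension `d`; its volume is `b ^ (-∑ⱼ kⱼ)`. -/
def box (b : ℕ) {d : ℕ} (k c : Fin d → ℕ) : Set (Fin d → ℝ) :=
  {x | ∀ j, (c j : ℝ) / (b : ℝ) ^ k j ≤ x j ∧ x j < ((c j : ℝ) + 1) / (b : ℝ) ^ k j}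

/-- The finite point sequence `a` in `[0, 1)ᵈ` is a `(lam, t, m, d)`-net in base `b`: it has
`N = lam * b ^ m` points, with `1 ≤ lam < b` and `t ≤ m`; every `b`-ary box of volume
`b ^ (t - m)` contains exactly `lam * b ^ t` of the points, and no `b`-ary box of volume
`b ^ (t - m - 1)` contains more than `b ^ t` of them. Points are counted with multiplicity. -/
structure IsNet (b lam t m d : ℕ) {N : ℕ} (a : Fin N → Fin d → ℝ) : Prop where
  one_le_lam : 1 ≤ lam
  lam_lt : lam < b
  t_le : t ≤ m
  card_eq : N = lam * b ^ m
  mem_Ico : ∀ n j, a n j ∈ Set.Ico (0 : ℝ) 1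
  box_eq : ∀ k c : Fin d → ℕ, (∀ j, c j < b ^ k j) → ∑ j, k j = m - t →
    {n : Fin N | a n ∈ box b k c}.ncard = lam * b ^ t
  box_le : ∀ k c : Fin d → ℕ, (∀ j, c j < b ^ k j) → ∑ j, k j = m - t + 1 →
    {n : Fin N | a n ∈ box b k c}.ncard ≤ b ^ t

/-- The finite strings of base-`b` digits, i.e. the nodes of the `b`-ary tree. -/
abbrev Prefix (b : ℕ) : Type := Σ k : ℕ, (Fin k → Fin b)

/-- Nested (Owen) scrambling of a digit sequence `z`, given one permutation of the digits for
every finite string: the digit of index `k` is permuted by the permutation attached to the string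
of the (unscrambled) digits that precede it. -/
def scrambleDigits {b : ℕ} (σ : Prefix b → Equiv.Perm (Fin b)) (z : ℕ → Fin b) : ℕ → Fin b :=
  fun k => σ ⟨k, fun i => z i⟩ (z k)

/-- Nested scrambling in base `b` of a real number of `[0, 1)` through its base-`b` digits. -/
noncomputable def scramble {b : ℕ} [NeZero b] (σ : Prefix b → Equiv.Perm (Fin b)) (x : ℝ) : ℝ :=
  Real.ofDigits (scrambleDigits σ (Real.digits x b))

/-- `π` is a family of independent random permutations of `{0, …, b - 1}`, one for every
coordinate `j` and every finite digit string, each uniform over the `b !` permutations. -/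
structure IsUniformPermFamily {Ω : Type*} [MeasurableSpace Ω] (μ : Measure Ω) {b d : ℕ}
    (π : Fin d × Prefix b → Ω → Equiv.Perm (Fin b)) : Prop where
  measurableSet : ∀ i s, MeasurableSet {ω | π i ω = s}
  uniform : ∀ i s, μ {ω | π i ω = s} = ((b.factorial : ℕ) : ENNReal)⁻¹
  indep : iIndepFun (m := fun _ => ⊤) π μ

/-- The random points `u₁, …, u_N` form a scrambled `(lam, t, m, d)`-net in base `b`: they are
obtained from a deterministic `(lam, t, m, d)`-net by Owen's nested uniform scrambling, the same
random permutations being applied to all the points. -/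
def IsScrambledNet {Ω : Type*} [MeasurableSpace Ω] (μ : Measure Ω) (b lam t m d : ℕ) [NeZero b]
    {N : ℕ} (u : Fin N → Ω → Fin d → ℝ) : Prop :=
  (∀ n, Measurable (u n)) ∧
    ∃ (a : Fin N → Fin d → ℝ) (π : Fin d × Prefix b → Ω → Equiv.Perm (Fin b)),
      IsNet b lam t m d a ∧ IsUniformPermFamily μ π ∧
        ∀ᵐ ω ∂μ, ∀ n j, u n ω j = scramble (fun s => π (j, s) ω) (a n j)

/-- Lebesgue measure on the unit cube `[0, 1]ᵈ`, the law `𝒰([0, 1]ᵈ)`. -/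
noncomputable def cubeMeasure (d : ℕ) : Measure (Fin d → ℝ) :=
  volume.restrict (Set.Icc 0 1)

end RQMC

namespace ABC

variable {Θ Y : Type*} [MeasurableSpace Θ] [MeasurableSpace Y]

/-- `g` is a probability density with respect to the reference measure `ν`. -/
structure IsDensity (ν : Measure Θ) (g : Θ → ℝ) : Prop where
  measurable : Measurable g
  nonneg : ∀ x, 0 ≤ g x
  lintegral_eq_one : ∫⁻ x, ENNReal.ofReal (g x) ∂ν = 1

/-- `f(θ) = (p(θ) / q(θ)) ℙ_θ(δ(y, y⋆) ≤ ε)`, where `ℙ_θ` is the law `lik θ` of a datapoint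
simulated from the model with parameter `θ`. -/
noncomputable def weightedProb (p q : Θ → ℝ) (lik : Kernel Θ Y) (δ : Y → Y → ℝ) (ystar : Y)
    (ε : ℝ) (θ : Θ) : ℝ :=
  p θ / q θ * (lik θ).real {y | δ y ystar ≤ ε}

/-- Conditionally on `θ₁, …, θ_N`, the datapoints `y n i` (`n ≤ N`, `i ≤ M`) are independent,
and `y n i` is distributed according to `lik (θ n)`. -/
structure IsSimulatedData {Ω : Type*} [MeasurableSpace Ω] (μ : Measure Ω) (lik : Kernel Θ Y)
    {N M : ℕ} (θ : Fin N → Ω → Θ) (y : Fin N → Fin M → Ω → Y) : Prop where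
  measurable : ∀ n i, Measurable (y n i)
  law : ∀ (A : Set (Fin N → Θ)) (B : Fin N → Fin M → Set Y), MeasurableSet A →
    (∀ n i, MeasurableSet (B n i)) →
    μ {ω | (fun n => θ n ω) ∈ A ∧ ∀ n i, y n i ω ∈ B n i} =
      ∫⁻ ω in {ω | (fun n => θ n ω) ∈ A}, ∏ n, ∏ i, lik (θ n ω) (B n i) ∂μ

open Classical in
/-- The estimator of the normalising constant,
`Ẑ_N = N⁻¹ ∑ₙ (p(θₙ) / q(θₙ)) [M⁻¹ ∑ᵢ 𝟙{δ(y_{n,i}, y⋆) ≤ ε}]`, as a random variable. -/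
noncomputable def normConstEst {Ω : Type*} (p q : Θ → ℝ) (δ : Y → Y → ℝ) (ystar : Y) (ε : ℝ)
    {N M : ℕ} (θ : Fin N → Ω → Θ) (y : Fin N → Fin M → Ω → Y) (ω : Ω) : ℝ :=
  (1 / (N : ℝ)) * ∑ n, p (θ n ω) / q (θ n ω) *
    ((1 / (M : ℝ)) * ∑ i, if δ (y n i ω) ystar ≤ ε then (1 : ℝ) else 0)

/-- The sigma-algebra generated by `θ₁, …, θ_N`. -/
abbrev sigmaTheta {Ω : Type*} {N : ℕ} (θ : Fin N → Ω → Θ) : MeasurableSpace Ω :=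
  MeasurableSpace.comap (fun ω n => θ n ω) inferInstance

end ABC

/-! Given the parameters, each acceptance indicator has mean `lik (θ n) D`, where `D` is the
acceptance region. The conditional expectation of the estimator is thus the average of `f ∘ Γ` over
the scrambled net, and the claim becomes Owen's theorem: such averages of an L² function `φ` have
variance o(1/N).

Points are treated as arrays of digits. A function of finitely many digits is a sum of pieces of
pure level `l`: each reads the first `l j` digits of coordinate `j` and averages to zero over the
last of them. Pieces of different levels are uncorrelated, even at different points of the net
(`integral_mul_eq_zero`). Let `L = m - t` and `C = lam * b ^ t`. A piece of nonzero level sums to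
exactly zero over the net when the total of `l` is at most `L`. Otherwise two points are correlated
only if they agree on all but the last digit read in each coordinate, which leaves at most `b ^ d *
C` partners per point. Hence the variance of the sum is at most `b ^ d * C * N` times the squared
norm (`variance_sum_le`), and `b ^ d * C` is bounded independently of the net.

To reach `φ` in L², fix a finite-digit `G₁` close to `φ`; it is integrated exactly once `L` is
large. For each `N`, choose a finite-digit `G₂` so close to `φ` that Cauchy–Schwarz disposes of `φ -
G₂`. The small finite-digit function `G₂ - G₁` obeys the variance bound
(`variance_sum_scrambled_le`). -/

namespace RQMC

/-! ### Digits of uniform random numbers -/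

/-- The integer whose base-`b` digits are the first `k` terms of `s`. -/
def prefixNum {b : ℕ} (s : ℕ → Fin b) : ℕ → ℕ
  | 0 => 0
  | k + 1 => b * prefixNum s k + s k

lemma prefixNum_lt {b : ℕ} (s : ℕ → Fin b) (k : ℕ) : prefixNum s k < b ^ k := by
  induction k with
  | zero => simp [prefixNum]
  | succ k ih =>
    have h := (s k).isLt
    calc prefixNum s (k + 1) < b * prefixNum s k + b := by simp [prefixNum]
      _ = b * (prefixNum s k + 1) := by ring
      _ ≤ b * b ^ k := Nat.mul_le_mul_left _ ih
      _ = b ^ (k + 1) := by ring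

/-- Induction through ⌊x b^(k+1)⌋ = b ⌊x b^k⌋ + (digit `k` of `x`); quotient and remainder modulo
`b` separate the last digit from the earlier ones. -/
lemma floor_mul_pow_eq_iff {b : ℕ} [NeZero b] {x : ℝ} (hx : x ∈ Set.Ico (0 : ℝ) 1)
    (s : ℕ → Fin b) (k : ℕ) :
    ⌊x * (b : ℝ) ^ k⌋₊ = prefixNum s k ↔ ∀ i < k, Real.digits x b i = s i := by
  have hb : b ≠ 0 := NeZero.ne b
  induction k with
  | zero => simp [prefixNum, Nat.floor_eq_zero.mpr hx.2]
  | succ k ih =>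
    have hdiv : ⌊x * (b : ℝ) ^ (k + 1)⌋₊ / b = ⌊x * (b : ℝ) ^ k⌋₊ := by
      rw [← Nat.floor_div_natCast, pow_succ, ← mul_assoc, mul_div_cancel_right₀]
      exact_mod_cast hb
    have hdig : (Real.digits x b k : ℕ) = ⌊x * (b : ℝ) ^ (k + 1)⌋₊ % b := by
      simp [Real.digits]
    have key : ⌊x * (b : ℝ) ^ (k + 1)⌋₊ = b * ⌊x * (b : ℝ) ^ k⌋₊ + (Real.digits x b k : ℕ) := by
      rw [hdig, ← hdiv, Nat.div_add_mod]
    refine Iff.trans ?_ ((and_congr_left' ih).trans Nat.forall_lt_succ_right.symm)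
    rw [key, Fin.ext_iff, prefixNum]
    constructor
    · intro h
      have h1 := congrArg (· / b) h
      have h2 := congrArg (· % b) h
      simp only [Nat.mul_add_div (Nat.pos_of_ne_zero hb), Nat.mul_add_mod,
        Nat.div_eq_of_lt (Fin.isLt _), Nat.mod_eq_of_lt (Fin.isLt _), add_zero] at h1 h2
      exact ⟨h1, h2⟩
    · rintro ⟨h1, h2⟩
      rw [h1, h2]

/-- The dictionary between `b`-ary intervals and digit prefixes, used for Lebesgue measure and for
nets alike. -/
lemma mem_Ico_iff_digits {b : ℕ} [NeZero b] {x : ℝ} (hx : x ∈ Set.Ico (0 : ℝ) 1)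
    (s : ℕ → Fin b) (k : ℕ) :
    ((prefixNum s k : ℝ) / (b : ℝ) ^ k ≤ x ∧ x < ((prefixNum s k : ℝ) + 1) / (b : ℝ) ^ k) ↔
      ∀ i < k, Real.digits x b i = s i := by
  have hb : (0 : ℝ) < (b : ℝ) ^ k := by
    have := NeZero.pos b
    positivity
  rw [← floor_mul_pow_eq_iff hx, div_le_iff₀ hb, lt_div_iff₀ hb,
    Nat.floor_eq_iff (mul_nonneg hx.1 hb.le)]

lemma measurable_digits (b : ℕ) [NeZero b] : Measurable fun x : ℝ => Real.digits x b := by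
  refine measurable_pi_lambda _ fun i => ?_
  have h : Measurable fun x : ℝ => ⌊x * (b : ℝ) ^ (i + 1)⌋₊ :=
    Nat.measurable_floor.comp (measurable_id.mul_const _)
  exact (measurable_of_countable (fun n : ℕ => Fin.ofNat b n)).comp h

/-- The uniform distribution on the digits `{0, …, b - 1}`. -/
noncomputable abbrev digitMeasure (b : ℕ) : Measure (Fin b) := uniformOn Set.univ

instance (b : ℕ) [NeZero b] : IsProbabilityMeasure (digitMeasure b) :=
  inferInstanceAs (IsProbabilityMeasure (uniformOn (Set.univ : Set (Fin b))))

lemma digitMeasure_singleton (b : ℕ) (c : Fin b) : digitMeasure b {c} = (b : ENNReal)⁻¹ := by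
  simp [digitMeasure, uniformOn_univ]

lemma volume_digits_eq {b : ℕ} [NeZero b] (s : ℕ → Fin b) (k : ℕ) :
    (volume.restrict (Set.Ico (0 : ℝ) 1)) {x | ∀ i < k, Real.digits x b i = s i} =
      (b : ENNReal)⁻¹ ^ k := by
  have hb : 0 < (b : ℝ) := by exact_mod_cast NeZero.pos b
  have hbk : (0 : ℝ) < (b : ℝ) ^ k := by positivity
  have hm : MeasurableSet {x : ℝ | ∀ i < k, Real.digits x b i = s i} := by
    have := measurable_digits b
    simp only [Set.ofPred_forall]
    refine MeasurableSet.iInter fun i => MeasurableSet.iInter fun _ => ?_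
    exact measurableSet_eq_fun ((measurable_pi_apply i).comp this) measurable_const
  rw [Measure.restrict_apply hm]
  have hlt : ((prefixNum s k : ℝ) + 1) ≤ (b : ℝ) ^ k := by
    exact_mod_cast prefixNum_lt s k
  have : {x : ℝ | ∀ i < k, Real.digits x b i = s i} ∩ Set.Ico (0 : ℝ) 1 =
      Set.Ico ((prefixNum s k : ℝ) / (b : ℝ) ^ k) (((prefixNum s k : ℝ) + 1) / (b : ℝ) ^ k) := by
    ext x
    constructor
    · rintro ⟨h, hx⟩
      exact (mem_Ico_iff_digits hx s k).2 h
    · intro h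
      have hx : x ∈ Set.Ico (0 : ℝ) 1 := by
        refine ⟨le_trans (by positivity) h.1, h.2.trans_le ?_⟩
        rwa [div_le_one hbk]
      exact ⟨(mem_Ico_iff_digits hx s k).1 h, hx⟩
  rw [this, Real.volume_Ico, ← sub_div, add_sub_cancel_left, one_div,
    ENNReal.ofReal_inv_of_pos hbk, ENNReal.ofReal_pow hb.le, ENNReal.ofReal_natCast,
    ENNReal.inv_pow]

/-- The digits of a uniform random number of `[0, 1)` are independent and uniform. -/
lemma map_digits (b : ℕ) [NeZero b] :
    (volume.restrict (Set.Ico (0 : ℝ) 1)).map (fun x => Real.digits x b) =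
      Measure.infinitePi fun _ : ℕ => digitMeasure b := by
  classical
  set ν : Measure (ℕ → Fin b) :=
    (volume.restrict (Set.Ico (0 : ℝ) 1)).map fun x => Real.digits x b with hν
  have hcyl (k : ℕ) : ν.map (fun z (i : Fin k) => z i) = Measure.pi fun _ => digitMeasure b := by
    have hmeas : Measurable fun (z : ℕ → Fin b) (i : Fin k) => z i := by fun_prop
    refine Measure.ext_of_singleton fun s => ?_
    rw [Measure.map_apply hmeas (measurableSet_singleton _), hν,
      Measure.map_apply (measurable_digits b) (hmeas (measurableSet_singleton _)),
      Measure.pi_singleton]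
    simp only [digitMeasure_singleton, Finset.prod_const, Finset.card_univ, Fintype.card_fin]
    rw [← volume_digits_eq (fun i => if h : i < k then s ⟨i, h⟩ else 0) k]
    congr 1
    ext x
    simp only [Set.mem_preimage, Set.mem_singleton_iff, Set.mem_ofPred_eq, funext_iff]
    constructor
    · intro h i hi
      simpa [hi] using h ⟨i, hi⟩
    · intro h i
      simpa using h i i.2
  refine Measure.eq_infinitePi _ fun s t ht => ?_
  obtain ⟨k, hk⟩ := s.exists_nat_subset_range
  -- Any finite set of sites lies in an initial segment; the sites added are left unconstrained, so
  -- they contribute factors 1.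
  have hset : (Set.pi (s : Set ℕ) t) =
      (fun (z : ℕ → Fin b) (i : Fin k) => z i) ⁻¹'
        (Set.univ.pi fun i : Fin k => if (i : ℕ) ∈ s then t i else Set.univ) := by
    ext z
    simp only [Set.mem_pi, Finset.mem_coe, Set.mem_preimage, Set.mem_univ, true_imp_iff]
    constructor
    · intro h i
      split_ifs with hi
      · exact h i hi
      · trivial
    · intro h i hi
      have := h ⟨i, Finset.mem_range.1 (hk hi)⟩
      simpa [hi] using this
  rw [hset, ← Measure.map_apply (by fun_prop), hcyl, Measure.pi_pi]
  · rw [Fin.prod_univ_eq_prod_range (fun i => digitMeasure b (if i ∈ s then t i else Set.univ)) k,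
      ← Finset.prod_subset hk]
    · exact Finset.prod_congr rfl fun i hi => by rw [if_pos hi]
    · intro i _ hi
      rw [if_neg hi, measure_univ]
  · refine MeasurableSet.univ_pi fun i => ?_
    split_ifs
    · exact ht _
    · exact MeasurableSet.univ

lemma measurable_ofDigits (b : ℕ) : Measurable (@Real.ofDigits b) := by
  unfold Real.ofDigits Real.ofDigitsTerm
  refine Measurable.tsum fun n => ?_
  exact ((measurable_of_countable (fun c : Fin b => ((c : ℕ) : ℝ))).comp
    (measurable_pi_apply n)).mul_const _

/-- `Real.ofDigits` inverts `Real.digits` on [0, 1), and the endpoint 1 is null. -/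
lemma map_ofDigits {b : ℕ} [NeZero b] (hb : 2 ≤ b) :
    (Measure.infinitePi fun _ : ℕ => digitMeasure b).map Real.ofDigits =
      volume.restrict (Set.Icc (0 : ℝ) 1) := by
  rw [← map_digits, Measure.map_map (measurable_ofDigits b) (measurable_digits b),
    ← restrict_Ico_eq_restrict_Icc]
  conv_rhs => rw [← Measure.map_id (μ := volume.restrict (Set.Ico (0 : ℝ) 1))]
  refine Measure.map_congr ?_
  filter_upwards [ae_restrict_mem measurableSet_Ico] with x hx
  exact Real.ofDigits_digits hb hx

/-- The uniform distribution on the digit arrays of the points of the `d`-dimensional cube. -/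
noncomputable abbrev arrayMeasure (b d : ℕ) : Measure (Fin d × ℕ → Fin b) :=
  Measure.infinitePi fun _ => digitMeasure b

/-- The point of the cube with a given array of digits. -/
noncomputable def toPoint {b d : ℕ} (z : Fin d × ℕ → Fin b) : Fin d → ℝ :=
  fun j => Real.ofDigits fun k => z (j, k)

lemma measurable_toPoint (b d : ℕ) : Measurable (@toPoint b d) :=
  measurable_pi_lambda _ fun j => (measurable_ofDigits b).comp
    (measurable_pi_lambda _ fun k => measurable_pi_apply (j, k))

lemma map_toPoint {b : ℕ} [NeZero b] (hb : 2 ≤ b) (d : ℕ) :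
    (arrayMeasure b d).map toPoint = cubeMeasure d := by
  have h1 := Measure.infinitePi_map_curry (fun (_ : Fin d) (_ : ℕ) => digitMeasure b)
  have h2 : (@toPoint b d) = (fun w j => Real.ofDigits (w j)) ∘
      (MeasurableEquiv.curry (Fin d) ℕ (Fin b)) := by
    ext z j
    rfl
  have hm : Measurable fun (w : Fin d → ℕ → Fin b) j => Real.ofDigits (w j) :=
    measurable_pi_lambda _ fun j => (measurable_ofDigits b).comp (measurable_pi_apply j)
  rw [h2, ← Measure.map_map hm (MeasurableEquiv.measurable _), h1, Measure.infinitePi_eq_pi,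
    Measure.pi_map_pi]
  · simp only [map_ofDigits hb]
    rw [cubeMeasure, volume_pi, ← Set.pi_univ_Icc, Measure.restrict_pi_pi]
    rfl
  · exact fun _ => (measurable_ofDigits b).aemeasurable

lemma toPoint_mem_Icc {b d : ℕ} (z : Fin d × ℕ → Fin b) : toPoint z ∈ Set.Icc (0 : Fin d → ℝ) 1 :=
  ⟨fun _ => Real.ofDigits_nonneg _, fun _ => Real.ofDigits_le_one _⟩

/-! ### Digit arrays and their scrambling -/

/-- Nested scrambling of the array of digits of a point. -/
def scrambleArray {b d : ℕ} (σ : Fin d × Prefix b → Equiv.Perm (Fin b))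
    (z : Fin d × ℕ → Fin b) : Fin d × ℕ → Fin b :=
  fun i => scrambleDigits (fun s => σ (i.1, s)) (fun k => z (i.1, k)) i.2

/-- Two arrays agree below level `l` if they have the same first `l j` digits in every
coordinate `j`. -/
def AgreeBelow {b d : ℕ} (l : Fin d → ℕ) (z w : Fin d × ℕ → Fin b) : Prop :=
  ∀ j k, k < l j → z (j, k) = w (j, k)

lemma AgreeBelow.mono {b d : ℕ} {l l' : Fin d → ℕ} (hl : l ≤ l') {z w : Fin d × ℕ → Fin b}
    (h : AgreeBelow l' z w) : AgreeBelow l z w := fun j k hk => h j k (hk.trans_le (hl j))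

/-- The inverse of nested scrambling on digit sequences. -/
def unscrambleDigits {b : ℕ} (σ : Prefix b → Equiv.Perm (Fin b)) (s : ℕ → Fin b) : ℕ → Fin b
  | k => (σ ⟨k, fun i : Fin k => unscrambleDigits σ s i⟩).symm (s k)
  decreasing_by exact i.2

lemma scrambleDigits_unscrambleDigits {b : ℕ} (σ : Prefix b → Equiv.Perm (Fin b))
    (s : ℕ → Fin b) : scrambleDigits σ (unscrambleDigits σ s) = s := by
  ext1 k
  rw [scrambleDigits, unscrambleDigits, Equiv.apply_symm_apply]

/-- While the earlier digits coincide, the same permutation acts on the next digit of both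
sequences, and it is injective. -/
lemma scrambleDigits_agree_iff {b : ℕ} (σ : Prefix b → Equiv.Perm (Fin b)) (z w : ℕ → Fin b)
    (k : ℕ) : (∀ i < k, scrambleDigits σ z i = scrambleDigits σ w i) ↔ ∀ i < k, z i = w i := by
  induction k with
  | zero => simp
  | succ k ih =>
    rw [Nat.forall_lt_succ_right, Nat.forall_lt_succ_right]
    refine (and_congr_left' ih).trans (and_congr_right fun h => ?_)
    have : (fun i : Fin k => z i) = fun i : Fin k => w i := funext fun i => h i i.2
    rw [scrambleDigits, scrambleDigits, this, (σ _).injective.eq_iff]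

lemma agreeBelow_scrambleArray_iff {b d : ℕ} (σ : Fin d × Prefix b → Equiv.Perm (Fin b))
    (l : Fin d → ℕ) (z w : Fin d × ℕ → Fin b) :
    AgreeBelow l (scrambleArray σ z) (scrambleArray σ w) ↔ AgreeBelow l z w :=
  forall_congr' fun j => scrambleDigits_agree_iff (fun s => σ (j, s)) (fun k => z (j, k)) (fun k => w (j, k)) (l j)

lemma exists_scrambleArray_eq {b d : ℕ} (σ : Fin d × Prefix b → Equiv.Perm (Fin b))
    (s : Fin d × ℕ → Fin b) : ∃ w, scrambleArray σ w = s := by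
  refine ⟨fun i => unscrambleDigits (fun p => σ (i.1, p)) (fun k => s (i.1, k)) i.2, ?_⟩
  ext1 i
  exact congrFun (scrambleDigits_unscrambleDigits (fun p => σ (i.1, p)) fun k => s (i.1, k)) i.2

/-! ### Equidistribution -/

open Classical in
/-- Every class of arrays that agree below level `l` contains exactly `C` of the arrays `z n`. -/
def Equidistributed {b d N : ℕ} (z : Fin N → Fin d × ℕ → Fin b) (l : Fin d → ℕ) (C : ℕ) : Prop :=
  ∀ s, (Finset.univ.filter fun n => AgreeBelow l (z n) s).card = C

/-- Scrambling is onto and both preserves and reflects agreement below `l`, so it permutes the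
classes. -/
lemma Equidistributed.scramble {b d N : ℕ} {z : Fin N → Fin d × ℕ → Fin b} {l : Fin d → ℕ}
    {C : ℕ} (h : Equidistributed z l C) (σ : Fin d × Prefix b → Equiv.Perm (Fin b)) :
    Equidistributed (fun n => scrambleArray σ (z n)) l C := by
  intro s
  obtain ⟨w, rfl⟩ := exists_scrambleArray_eq σ s
  rw [← h w]
  congr 1
  ext n
  simp [agreeBelow_scrambleArray_iff]

lemma agreeBelow_update_succ_iff {b d : ℕ} {l : Fin d → ℕ} (j : Fin d)
    (z s : Fin d × ℕ → Fin b) (c : Fin b) :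
    AgreeBelow (Function.update l j (l j + 1)) z (Function.update s (j, l j) c) ↔
      AgreeBelow l z s ∧ z (j, l j) = c := by
  constructor
  · intro h
    refine ⟨fun i k hk => ?_, ?_⟩
    · have h1 := h i k (by
        rcases eq_or_ne i j with rfl | hij
        · simpa using hk.le
        · simpa [hij] using hk)
      rwa [Function.update_of_ne] at h1
      rintro ⟨rfl, rfl⟩
      exact lt_irrefl _ hk
    · simpa using h j (l j) (by simp)
  · rintro ⟨h, rfl⟩ i k hk
    by_cases hi : (i, k) = (j, l j)
    · rw [hi, Function.update_self]
    · rw [Function.update_of_ne hi]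
      refine h i k ?_
      rcases eq_or_ne i j with rfl | hij
      · simp only [Function.update_self] at hk
        have : k ≠ l i := fun h => hi (by rw [h])
        omega
      · simpa [hij] using hk

/-- A class at level `l` splits into `b` finer classes according to the next digit of coordinate
`j`. -/
lemma Equidistributed.of_update_succ {b d N : ℕ} {z : Fin N → Fin d × ℕ → Fin b}
    {l : Fin d → ℕ} {C : ℕ} (j : Fin d)
    (h : Equidistributed z (Function.update l j (l j + 1)) C) : Equidistributed z l (b * C) := by
  classical
  intro s
  rw [Finset.card_eq_sum_card_fiberwise (f := fun n => z n (j, l j)) (t := Finset.univ)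
    (fun _ _ => Finset.mem_univ _)]
  have hc (c : Fin b) : ((Finset.univ.filter fun n => AgreeBelow l (z n) s).filter
      fun n => z n (j, l j) = c).card = C := by
    rw [Finset.filter_filter, ← h (Function.update s (j, l j) c)]
    simp only [agreeBelow_update_succ_iff]
  simp [hc]

/-- A level of smaller total is refined up to total `L` by adding digits to coordinate 0, each for a
factor `b`. -/
lemma Equidistributed.of_sum_le {b d N : ℕ} (hd : 0 < d) {z : Fin N → Fin d × ℕ → Fin b}
    {L C : ℕ} (h : ∀ l : Fin d → ℕ, ∑ j, l j = L → Equidistributed z l C) (r : ℕ)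
    (l : Fin d → ℕ) (hl : ∑ j, l j + r = L) : Equidistributed z l (b ^ r * C) := by
  induction r generalizing l with
  | zero => simpa using h l (by simpa using hl)
  | succ r ih =>
    have := ih (Function.update l ⟨0, hd⟩ (l ⟨0, hd⟩ + 1)) (by
      rw [Finset.sum_update_of_mem (Finset.mem_univ _)]
      have h2 := Finset.add_sum_erase Finset.univ l (Finset.mem_univ ⟨0, hd⟩)
      rw [Finset.sdiff_singleton_eq_erase]
      omega)
    have h3 := this.of_update_succ
    rwa [← mul_assoc, ← pow_succ'] at h3

/-- The array of the base-`b` digits of a point. -/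
noncomputable def digitArray (b : ℕ) [NeZero b] {d : ℕ} (x : Fin d → ℝ) : Fin d × ℕ → Fin b :=
  fun i => Real.digits (x i.1) b i.2

lemma mem_box_iff {b d : ℕ} [NeZero b] {x : Fin d → ℝ} (hx : ∀ j, x j ∈ Set.Ico (0 : ℝ) 1)
    (l : Fin d → ℕ) (s : Fin d × ℕ → Fin b) :
    x ∈ box b l (fun j => prefixNum (fun k => s (j, k)) (l j)) ↔
      AgreeBelow l (digitArray b x) s :=
  forall_congr' fun j => mem_Ico_iff_digits (hx j) (fun k => s (j, k)) (l j)

lemma IsNet.equidistributed {b lam t m d N : ℕ} [NeZero b] {a : Fin N → Fin d → ℝ}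
    (ha : IsNet b lam t m d a) (l : Fin d → ℕ) (hl : ∑ j, l j = m - t) :
    Equidistributed (fun n => digitArray b (a n)) l (lam * b ^ t) := by
  classical
  intro s
  rw [← ha.box_eq l (fun j => prefixNum (fun k => s (j, k)) (l j))
    (fun j => prefixNum_lt _ _) hl, ← Set.ncard_coe_finset]
  congr 1
  ext n
  simp [mem_box_iff (ha.mem_Ico n)]

/-! ### Averaging over one digit -/

/-- Add `c` modulo `b` to the digit at site `i`. -/
def shiftDigit {b d : ℕ} [NeZero b] (i : Fin d × ℕ) (c : Fin b) (z : Fin d × ℕ → Fin b) :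
    Fin d × ℕ → Fin b :=
  Function.update z i (z i + c)

/-- Average a function of a digit array over the digit at site `i`. -/
noncomputable def avgDigit {b d : ℕ} [NeZero b] (i : Fin d × ℕ) :
    ((Fin d × ℕ → Fin b) → ℝ) →ₗ[ℝ] ((Fin d × ℕ → Fin b) → ℝ) where
  toFun G z := (b : ℝ)⁻¹ * ∑ c, G (shiftDigit i c z)
  map_add' G H := by
    ext z
    simp [Finset.sum_add_distrib, mul_add]
  map_smul' a G := by
    ext z
    simp [Finset.mul_sum, mul_left_comm]

lemma avgDigit_apply {b d : ℕ} [NeZero b] (i : Fin d × ℕ) (G : (Fin d × ℕ → Fin b) → ℝ)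
    (z : Fin d × ℕ → Fin b) : avgDigit i G z = (b : ℝ)⁻¹ * ∑ c, G (shiftDigit i c z) := rfl

/-- The shift form matches translations of a random permutation; this form shows that the average no
longer reads digit `i`. -/
lemma avgDigit_eq_update {b d : ℕ} [NeZero b] (i : Fin d × ℕ) (G : (Fin d × ℕ → Fin b) → ℝ)
    (z : Fin d × ℕ → Fin b) :
    avgDigit i G z = (b : ℝ)⁻¹ * ∑ c, G (Function.update z i c) := by
  rw [avgDigit_apply]
  congr 1
  exact Equiv.sum_comp (Equiv.addLeft (z i)) fun c => G (Function.update z i c)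

lemma avgDigit_update {b d : ℕ} [NeZero b] (i : Fin d × ℕ) (G : (Fin d × ℕ → Fin b) → ℝ)
    (z : Fin d × ℕ → Fin b) (c : Fin b) : avgDigit i G (Function.update z i c) = avgDigit i G z := by
  simp [avgDigit_eq_update]

lemma avgDigit_avgDigit {b d : ℕ} [NeZero b] (i : Fin d × ℕ) (G : (Fin d × ℕ → Fin b) → ℝ) :
    avgDigit i (avgDigit i G) = avgDigit i G := by
  have hb : (b : ℝ) ≠ 0 := by exact_mod_cast NeZero.ne b
  ext z
  rw [avgDigit_eq_update]
  simp [avgDigit_update, hb]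

lemma avgDigit_comm {b d : ℕ} [NeZero b] (i i' : Fin d × ℕ) (G : (Fin d × ℕ → Fin b) → ℝ) :
    avgDigit i (avgDigit i' G) = avgDigit i' (avgDigit i G) := by
  rcases eq_or_ne i i' with rfl | h
  · rfl
  ext z
  simp only [avgDigit_eq_update, ← Finset.mul_sum]
  rw [Finset.sum_comm]
  simp only [Function.update_comm h]

/-- The functions of a digit array that depend only on the digits below level `l` and whose
average over the last of these digits vanishes in each coordinate of `J`. -/
def levelSpace (b : ℕ) [NeZero b] {d : ℕ} (J : Finset (Fin d)) (l : Fin d → ℕ) :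
    Submodule ℝ ((Fin d × ℕ → Fin b) → ℝ) where
  carrier := {G | (∀ z w, AgreeBelow l z w → G z = G w) ∧
    ∀ j ∈ J, 0 < l j → avgDigit (j, l j - 1) G = 0}
  add_mem' := by
    rintro G H ⟨hG, hG'⟩ ⟨hH, hH'⟩
    refine ⟨fun z w h => ?_, fun j hj hl => ?_⟩
    · simp [hG z w h, hH z w h]
    · rw [map_add, hG' j hj hl, hH' j hj hl, add_zero]
  zero_mem' := ⟨fun _ _ _ => rfl, fun _ _ _ => map_zero _⟩
  smul_mem' := by
    rintro a G ⟨hG, hG'⟩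
    refine ⟨fun z w h => ?_, fun j hj hl => ?_⟩
    · simp [hG z w h]
    · rw [map_smul, hG' j hj hl, smul_zero]

lemma AgreeBelow.update {b d : ℕ} {l : Fin d → ℕ} {z w : Fin d × ℕ → Fin b}
    (h : AgreeBelow l z w) (i : Fin d × ℕ) (c : Fin b) :
    AgreeBelow l (Function.update z i c) (Function.update w i c) := by
  intro j k hk
  by_cases hi : (j, k) = i
  · subst hi
    simp
  · simpa [Function.update_of_ne hi] using h j k hk

/-- Coordinates are purified one at a time. For `j ∉ J`, let `A` be the average of `G` over the last
digit of `j`: then `G - A` is pure in `j` as well, while `A` has level lowered by one in `j`. Both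
moves decrease ∑_{j ∉ J} (l j + 1); the `+ 1` makes enlarging `J` count even when `l j = 0`. -/
lemma levelSpace_le_iSup {b : ℕ} [NeZero b] {d : ℕ} (J : Finset (Fin d)) (l : Fin d → ℕ) :
    levelSpace b J l ≤ ⨆ l' : Set.Iic l, levelSpace b Finset.univ l'.1 := by
  obtain ⟨r, hr⟩ : ∃ r, r = ∑ j ∈ Jᶜ, (l j + 1) := ⟨_, rfl⟩
  induction r using Nat.strong_induction_on generalizing J l with
  | _ r ih =>
  intro G hG
  by_cases hJ : J = Finset.univ
  · subst hJ
    exact Submodule.mem_iSup_of_mem ⟨l, Set.mem_Iic.2 le_rfl⟩ hG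
  obtain ⟨j, hj⟩ : ∃ j, j ∉ J := by
    simpa [Finset.eq_univ_iff_forall] using hJ
  have hsplit : ∑ i ∈ Jᶜ, (l i + 1) = (l j + 1) + ∑ i ∈ (insert j J)ᶜ, (l i + 1) := by
    rw [Finset.compl_insert, Finset.add_sum_erase _ (fun i => l i + 1) (Finset.mem_compl.2 hj)]
  have hstep : ∀ H ∈ levelSpace b (insert j J) l,
      H ∈ ⨆ l' : Set.Iic l, levelSpace b Finset.univ l'.1 :=
    ih _ (by omega) (insert j J) l rfl
  rcases Nat.eq_zero_or_pos (l j) with h0 | hpos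
  · refine hstep G ⟨hG.1, fun i hi hl => ?_⟩
    rcases Finset.mem_insert.1 hi with rfl | hi
    · omega
    · exact hG.2 i hi hl
  set A : (Fin d × ℕ → Fin b) → ℝ := avgDigit (j, l j - 1) G with hA
  set l₁ := Function.update l j (l j - 1) with hl₁
  have hle : l₁ ≤ l := by
    intro i
    rcases eq_or_ne i j with rfl | hij
    · simp [hl₁]
    · simp [hl₁, hij]
  have hAl : ∀ z w, AgreeBelow l₁ z w → A z = A w := by
    intro z w h
    rw [hA, avgDigit_eq_update, avgDigit_eq_update]
    congr 1
    refine Finset.sum_congr rfl fun c _ => hG.1 _ _ fun i k hk => ?_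
    by_cases hi : (i, k) = (j, l j - 1)
    · rw [hi]
      simp
    · rw [Function.update_of_ne hi, Function.update_of_ne hi]
      refine h i k ?_
      rcases eq_or_ne i j with rfl | hij
      · have : k ≠ l i - 1 := fun h => hi (by rw [h])
        simp only [hl₁, Function.update_self]
        omega
      · simpa [hl₁, hij] using hk
  have hAJ : ∀ i ∈ J, 0 < l i → avgDigit (i, l i - 1) A = 0 := by
    intro i hi hli
    rw [hA, avgDigit_comm, hG.2 i hi hli, map_zero]
  have hA₁ : A ∈ levelSpace b J l₁ := by
    refine ⟨hAl, fun i hi hli => ?_⟩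
    have hij : i ≠ j := fun h => hj (h ▸ hi)
    simp only [hl₁, Function.update_of_ne hij] at hli ⊢
    exact hAJ i hi hli
  have hsum : ∑ i ∈ Jᶜ, (l₁ i + 1) < r := by
    rw [hr]
    refine Finset.sum_lt_sum (fun i _ => Nat.add_le_add_right (hle i) 1)
      ⟨j, Finset.mem_compl.2 hj, ?_⟩
    simp only [hl₁, Function.update_self]
    omega
  have hAmem : A ∈ ⨆ l' : Set.Iic l, levelSpace b Finset.univ l'.1 := by
    refine (iSup_le fun l' => ?_ : (⨆ l' : Set.Iic l₁, levelSpace b Finset.univ l'.1) ≤ _)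
      (ih _ hsum J l₁ rfl hA₁)
    exact le_iSup (fun l' : Set.Iic l => levelSpace b Finset.univ l'.1)
      ⟨l'.1, le_trans l'.2 hle⟩
  have hdiff : G - A ∈ levelSpace b (insert j J) l := by
    refine ⟨fun z w h => ?_, fun i hi hli => ?_⟩
    · simp [hG.1 z w h, hAl z w (h.mono hle)]
    · rw [map_sub]
      rcases Finset.mem_insert.1 hi with rfl | hi
      · rw [hA, avgDigit_avgDigit, sub_self]
      · rw [hG.2 i hi hli, hAJ i hi hli, sub_zero]
  have := Submodule.add_mem _ (hstep _ hdiff) hAmem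
  rwa [sub_add_cancel] at this

/-- A function of finitely many digits is a finite sum of functions of pure level. -/
lemma exists_eq_sum_levelSpace {b : ℕ} [NeZero b] {d : ℕ} {l : Fin d → ℕ}
    {G : (Fin d × ℕ → Fin b) → ℝ} (hG : ∀ z w, AgreeBelow l z w → G z = G w) :
    ∃ (F : Finset (Fin d → ℕ)) (g : (Fin d → ℕ) → (Fin d × ℕ → Fin b) → ℝ),
      (∀ l' ∈ F, l' ≤ l ∧ g l' ∈ levelSpace b Finset.univ l') ∧ G = ∑ l' ∈ F, g l' := by
  -- For `J = ∅` the condition on averages is void.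
  have h := levelSpace_le_iSup (b := b) ∅ l (⟨hG, by simp⟩ : G ∈ levelSpace b ∅ l)
  obtain ⟨f, hf, hsum⟩ := (Submodule.mem_iSup_iff_exists_finsupp _ _).1 h
  classical
  refine ⟨Finset.Iic l, fun l' => if h : l' ≤ l then f ⟨l', h⟩ else 0, fun l' hl' => ?_, ?_⟩
  · have := Finset.mem_Iic.1 hl'
    refine ⟨this, ?_⟩
    simp only [this, dif_pos]
    exact hf ⟨l', this⟩
  · rw [← hsum, Finsupp.sum_fintype _ _ (fun _ => rfl)]
    refine Finset.sum_bij (fun x _ => x.1) (fun x _ => Finset.mem_Iic.2 x.2)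
      (fun x _ y _ h => Subtype.ext h) (fun x hx => ⟨⟨x, Finset.mem_Iic.1 hx⟩, by simp, rfl⟩) ?_
    rintro ⟨x, hx⟩ _
    have : x ≤ l := hx
    simp [this]

/-- Sums over an equidistributed family do not change when one digit is averaged. -/
lemma Equidistributed.sum_shiftDigit {b d N : ℕ} [NeZero b] {z : Fin N → Fin d × ℕ → Fin b}
    {l : Fin d → ℕ} {C : ℕ} (hz : Equidistributed z l C) (hC : C ≠ 0)
    {G : (Fin d × ℕ → Fin b) → ℝ} (hG : ∀ z w, AgreeBelow l z w → G z = G w)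
    (i : Fin d × ℕ) (c : Fin b) : ∑ n, G (shiftDigit i c (z n)) = ∑ n, G (z n) := by
  classical
  have hshift (z w : Fin d × ℕ → Fin b) :
      AgreeBelow l z (shiftDigit i c w) ↔ AgreeBelow l w (shiftDigit i (-c) z) := by
    unfold AgreeBelow shiftDigit
    refine forall_congr' fun j => forall_congr' fun k => imp_congr_right fun _ => ?_
    by_cases hi : (j, k) = i
    · subst hi
      simp only [Function.update_self]
      constructor <;> intro h <;> simp [h]
    · simp only [Function.update_of_ne hi]
      exact eq_comm
  have hC' : (C : ℝ) ≠ 0 := by exact_mod_cast hC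
  refine mul_left_cancel₀ hC' ?_
  -- Double counting of pairs with one point in the class of the other's shift: each shifted point
  -- has exactly `C` classmates in the family, and shifting back by `-c` gives the same count from
  -- the other side.
  calc (C : ℝ) * ∑ n, G (shiftDigit i c (z n))
      = ∑ n, ∑ n' with AgreeBelow l (z n') (shiftDigit i c (z n)),
          G (shiftDigit i c (z n)) := by
        simp [hz _, Finset.mul_sum]
    _ = ∑ n, ∑ n' with AgreeBelow l (z n') (shiftDigit i c (z n)), G (z n') := by
        refine Finset.sum_congr rfl fun n _ => Finset.sum_congr rfl fun n' hn' => ?_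
        exact (hG _ _ (Finset.mem_filter.1 hn').2).symm
    _ = ∑ n', ∑ n with AgreeBelow l (z n) (shiftDigit i (-c) (z n')), G (z n') := by
        simp only [Finset.sum_filter, hshift]
        exact Finset.sum_comm
    _ = (C : ℝ) * ∑ n, G (z n) := by
        simp [hz _, Finset.mul_sum]

/-- Averaging over the last digit of a coordinate with `l j > 0` kills `G` but leaves the sum
unchanged. -/
lemma Equidistributed.sum_eq_zero {b d N : ℕ} [NeZero b] {z : Fin N → Fin d × ℕ → Fin b}
    {l : Fin d → ℕ} {C : ℕ} (hz : Equidistributed z l C) (hC : C ≠ 0)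
    {G : (Fin d × ℕ → Fin b) → ℝ} (hG : G ∈ levelSpace b Finset.univ l) (hl : l ≠ 0) :
    ∑ n, G (z n) = 0 := by
  obtain ⟨j, hj⟩ := Function.ne_iff.1 hl
  have hj : 0 < l j := Nat.pos_of_ne_zero hj
  have hb : (b : ℝ) ≠ 0 := by exact_mod_cast NeZero.ne b
  have h0 : ∑ n, avgDigit (j, l j - 1) G (z n) = 0 := by
    rw [hG.2 j (Finset.mem_univ j) hj]
    simp
  simp only [avgDigit_apply] at h0
  rw [← Finset.mul_sum, Finset.sum_comm] at h0
  simp only [hz.sum_shiftDigit hC hG.1] at h0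
  simpa [hb] using h0

/-! ### The law of a scrambled array -/

instance instMeasurableSpacePermFin (b : ℕ) : MeasurableSpace (Equiv.Perm (Fin b)) := ⊤

instance instDiscretePermFin (b : ℕ) : DiscreteMeasurableSpace (Equiv.Perm (Fin b)) :=
  ⟨fun _ => trivial⟩

/-- The uniform distribution on the permutations of the digits. -/
noncomputable abbrev permMeasure (b : ℕ) : Measure (Equiv.Perm (Fin b)) := uniformOn Set.univ

instance (b : ℕ) : IsProbabilityMeasure (permMeasure b) :=
  inferInstanceAs (IsProbabilityMeasure (uniformOn (Set.univ : Set (Equiv.Perm (Fin b)))))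

lemma permMeasure_singleton (b : ℕ) (τ : Equiv.Perm (Fin b)) :
    permMeasure b {τ} = ((b.factorial : ℕ) : ENNReal)⁻¹ := by
  simp [permMeasure, uniformOn_univ, Fintype.card_perm]

lemma map_mul_left_permMeasure (b : ℕ) (τ : Equiv.Perm (Fin b)) :
    (permMeasure b).map (τ * ·) = permMeasure b := by
  refine Measure.ext_of_singleton fun ρ => ?_
  rw [Measure.map_apply (Measurable.of_discrete) (measurableSet_singleton _),
    permMeasure_singleton]
  have : (fun x => τ * x) ⁻¹' {ρ} = {τ⁻¹ * ρ} := by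
    ext x
    simp [eq_inv_mul_iff_mul_eq]
  rw [this, permMeasure_singleton]

/-- Composing with a transposition preserves the uniform law, so all digits have equal mass. -/
lemma map_apply_permMeasure (b : ℕ) [NeZero b] (c : Fin b) :
    (permMeasure b).map (fun τ => τ c) = digitMeasure b := by
  have hm : Measurable fun τ : Equiv.Perm (Fin b) => τ c := Measurable.of_discrete
  set ρ := (permMeasure b).map fun τ => τ c with hρ
  have : IsProbabilityMeasure ρ := Measure.isProbabilityMeasure_map hm.aemeasurable
  have heq (e e' : Fin b) : ρ {e} = ρ {e'} := by
    have h1 : ρ.map (Equiv.swap e e') = ρ := by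
      rw [hρ, Measure.map_map Measurable.of_discrete hm]
      conv_rhs => rw [← map_mul_left_permMeasure b (Equiv.swap e e'),
        Measure.map_map hm Measurable.of_discrete]
      rfl
    conv_lhs => rw [← h1]
    rw [Measure.map_apply Measurable.of_discrete (measurableSet_singleton _)]
    congr 1
    ext x
    simp [Equiv.swap_apply_eq_iff]
  refine Measure.ext_of_singleton fun e => ?_
  rw [digitMeasure_singleton]
  have hsum : ∑ e', ρ {e'} = 1 := by
    rw [sum_measure_singleton, Finset.coe_univ, measure_univ]
  rw [Finset.sum_congr rfl fun e' _ => heq e' e] at hsum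
  simp only [Finset.sum_const, Finset.card_univ, Fintype.card_fin, nsmul_eq_mul] at hsum
  exact ENNReal.eq_inv_of_mul_eq_one_left (by rwa [mul_comm])

/-- The law of a family of independent uniform permutations indexed by the coordinates and the
finite digit strings. -/
noncomputable abbrev familyMeasure (b d : ℕ) : Measure (Fin d × Prefix b → Equiv.Perm (Fin b)) :=
  Measure.infinitePi fun _ => permMeasure b

lemma IsUniformPermFamily.measurable {Ω : Type*} [MeasurableSpace Ω] {μ : Measure Ω} {b d : ℕ}
    {π : Fin d × Prefix b → Ω → Equiv.Perm (Fin b)} (h : IsUniformPermFamily μ π)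
    (i : Fin d × Prefix b) : Measurable (π i) :=
  measurable_to_countable' fun s => h.measurableSet i s

lemma IsUniformPermFamily.map_eq {Ω : Type*} [MeasurableSpace Ω] {μ : Measure Ω}
    [IsProbabilityMeasure μ] {b d : ℕ} {π : Fin d × Prefix b → Ω → Equiv.Perm (Fin b)}
    (h : IsUniformPermFamily μ π) : μ.map (fun ω i => π i ω) = familyMeasure b d := by
  rw [iIndepFun.map_fun_eq_infinitePi_map h.measurable h.indep]
  congr 1
  ext1 i
  refine Measure.ext_of_singleton fun s => ?_
  rw [Measure.map_apply (h.measurable i) (measurableSet_singleton _), permMeasure_singleton,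
    ← h.uniform i s]
  rfl

lemma measurable_scrambleArray {b d : ℕ} (z : Fin d × ℕ → Fin b) :
    Measurable fun σ : Fin d × Prefix b → Equiv.Perm (Fin b) => scrambleArray σ z := by
  refine measurable_pi_lambda _ fun i => ?_
  exact (Measurable.of_discrete (f := fun τ : Equiv.Perm (Fin b) => τ (z i))).comp
    (measurable_pi_apply ((i.1, ⟨i.2, fun k => z (i.1, k)⟩) : Fin d × Prefix b))

/-- A fixed array meets a different node of the tree at each coordinate and depth, so its digits are
moved by independent uniform permutations. -/
lemma map_scrambleArray {b d : ℕ} [NeZero b] (z : Fin d × ℕ → Fin b) :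
    (familyMeasure b d).map (fun σ => scrambleArray σ z) = arrayMeasure b d := by
  let f : Fin d × ℕ → Fin d × Prefix b := fun i => (i.1, ⟨i.2, fun k => z (i.1, k)⟩)
  have hf : Function.Injective f := by
    rintro ⟨j, k⟩ ⟨j', k'⟩ h
    simp only [f, Prod.mk.injEq, Sigma.mk.injEq] at h
    rw [h.1, h.2.1]
  have h1 := Measure.map_infinitePi_infinitePi_of_inj (P := fun _ => permMeasure b) hf
  have h2 := Measure.infinitePi_map_pi (fun _ : Fin d × ℕ => permMeasure b)
    (f := fun i (τ : Equiv.Perm (Fin b)) => τ (z i)) (fun _ => Measurable.of_discrete)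
  simp only [map_apply_permMeasure] at h2
  rw [arrayMeasure, ← h2, ← h1, Measure.map_map]
  · rfl
  · exact measurable_pi_lambda _ fun i =>
      (Measurable.of_discrete (f := fun τ : Equiv.Perm (Fin b) => τ (z i))).comp
        (measurable_pi_apply i)
  · exact measurable_pi_lambda _ fun i => measurable_pi_apply (f i)

lemma measurable_update_mul {b d : ℕ} (s : Fin d × Prefix b) (τ : Equiv.Perm (Fin b)) :
    Measurable fun σ : Fin d × Prefix b → Equiv.Perm (Fin b) =>
      Function.update σ s (τ * σ s) := by
  refine measurable_pi_lambda _ fun i => ?_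
  by_cases hi : i = s
  · subst hi
    simp only [Function.update_self]
    exact (Measurable.of_discrete (f := fun ρ : Equiv.Perm (Fin b) => τ * ρ)).comp
      (measurable_pi_apply i)
  · simp only [Function.update_of_ne hi]
    exact measurable_pi_apply i

/-- The symmetry behind all the orthogonality: translating the permutation at a single node does not
change the law of the family. -/
lemma map_update_mul {b d : ℕ} (s : Fin d × Prefix b) (τ : Equiv.Perm (Fin b)) :
    (familyMeasure b d).map (fun σ => Function.update σ s (τ * σ s)) = familyMeasure b d := by
  classical
  have h := Measure.infinitePi_map_pi (fun _ : Fin d × Prefix b => permMeasure b)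
    (f := fun i (ρ : Equiv.Perm (Fin b)) => if i = s then τ * ρ else ρ)
    (fun _ => Measurable.of_discrete)
  have h1 (i : Fin d × Prefix b) : (permMeasure b).map
      (fun ρ : Equiv.Perm (Fin b) => if i = s then τ * ρ else ρ) = permMeasure b := by
    split_ifs
    · exact map_mul_left_permMeasure b τ
    · exact Measure.map_id
  simp only [h1] at h
  conv_rhs => rw [familyMeasure, ← h]
  congr 1
  ext1 σ
  ext1 i
  by_cases hi : i = s
  · subst hi
    simp
  · simp [hi]

/-! ### Functions of finitely many digits -/

/-- Factoring through a finite set makes measurability and boundedness automatic; digits beyond `l`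
are filled with 0. -/
lemma exists_factor {b d : ℕ} [NeZero b] {l : Fin d → ℕ} {G : (Fin d × ℕ → Fin b) → ℝ}
    (hG : ∀ z w, AgreeBelow l z w → G z = G w) :
    ∃ g : ((p : Σ j, Fin (l j)) → Fin b) → ℝ, ∀ z, G z = g fun p => z (p.1, p.2) := by
  refine ⟨fun r => G fun i => if h : i.2 < l i.1 then r ⟨i.1, ⟨i.2, h⟩⟩ else 0, fun z => ?_⟩
  refine hG _ _ fun j k hk => ?_
  simp [hk]

lemma measurable_of_agreeBelow {b d : ℕ} [NeZero b] {l : Fin d → ℕ}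
    {G : (Fin d × ℕ → Fin b) → ℝ} (hG : ∀ z w, AgreeBelow l z w → G z = G w) : Measurable G := by
  obtain ⟨g, hg⟩ := exists_factor hG
  rw [show G = g ∘ fun z p => z (p.1, p.2) from funext hg]
  exact (measurable_of_countable g).comp
    (measurable_pi_lambda _ fun p => measurable_pi_apply (p.1, (p.2 : ℕ)))

lemma exists_bound_of_agreeBelow {b d : ℕ} [NeZero b] {l : Fin d → ℕ}
    {G : (Fin d × ℕ → Fin b) → ℝ} (hG : ∀ z w, AgreeBelow l z w → G z = G w) :
    ∃ B : ℝ, ∀ z, ‖G z‖ ≤ B := by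
  obtain ⟨g, hg⟩ := exists_factor hG
  obtain ⟨B, hB⟩ := (Set.finite_range fun r => ‖g r‖).bddAbove
  exact ⟨B, fun z => hg z ▸ hB ⟨_, rfl⟩⟩

lemma memLp_of_agreeBelow {b d : ℕ} [NeZero b] {l : Fin d → ℕ}
    {G : (Fin d × ℕ → Fin b) → ℝ} (hG : ∀ z w, AgreeBelow l z w → G z = G w) :
    MemLp G 2 (arrayMeasure b d) := by
  obtain ⟨B, hB⟩ := exists_bound_of_agreeBelow hG
  exact MemLp.of_bound (measurable_of_agreeBelow hG).aestronglyMeasurable B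
    (Filter.Eventually.of_forall hB)

lemma memLp_comp_scrambleArray {b d : ℕ} [NeZero b] {G : (Fin d × ℕ → Fin b) → ℝ}
    (hG : MemLp G 2 (arrayMeasure b d)) (z : Fin d × ℕ → Fin b) :
    MemLp (fun σ => G (scrambleArray σ z)) 2 (familyMeasure b d) := by
  rw [← map_scrambleArray z] at hG
  exact hG.comp_of_map (measurable_scrambleArray z).aemeasurable

lemma integral_comp_scrambleArray {b d : ℕ} [NeZero b] {G : (Fin d × ℕ → Fin b) → ℝ}
    (hG : AEStronglyMeasurable G (arrayMeasure b d)) (z : Fin d × ℕ → Fin b) :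
    ∫ σ, G (scrambleArray σ z) ∂familyMeasure b d = ∫ w, G w ∂arrayMeasure b d := by
  rw [← map_scrambleArray z] at hG ⊢
  rw [integral_map (measurable_scrambleArray z).aemeasurable hG]

lemma scrambleArray_update {b d : ℕ} [NeZero b] (σ : Fin d × Prefix b → Equiv.Perm (Fin b))
    (z : Fin d × ℕ → Fin b) (j : Fin d) (k : ℕ) (c : Fin b) :
    scrambleArray (Function.update σ (j, ⟨k, fun i => z (j, i)⟩)
      (Equiv.addRight c * σ (j, ⟨k, fun i => z (j, i)⟩))) z =
      shiftDigit (j, k) c (scrambleArray σ z) := by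
  ext1 ⟨j', k'⟩
  unfold shiftDigit
  by_cases h : (j', k') = (j, k)
  · rw [h, Function.update_self]
    simp [scrambleArray, scrambleDigits]
  · rw [Function.update_of_ne h]
    simp only [scrambleArray, scrambleDigits]
    rw [Function.update_of_ne]
    intro h'
    simp only [Prod.mk.injEq, Sigma.mk.injEq] at h'
    exact h (by rw [h'.1, h'.2.1])

/-- The modified node affects only digit `k` of coordinate `j`, and only for arrays sharing the
first `k` digits of `z` there. Either level `l` does not read that digit, or `w` has left the path
of `z` earlier. -/
lemma agreeBelow_scrambleArray_update {b d : ℕ} (σ : Fin d × Prefix b → Equiv.Perm (Fin b))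
    (z w : Fin d × ℕ → Fin b) (j : Fin d) (k : ℕ) (τ : Equiv.Perm (Fin b)) {l : Fin d → ℕ}
    (h : l j ≤ k ∨ ∃ i < k, z (j, i) ≠ w (j, i)) :
    AgreeBelow l (scrambleArray (Function.update σ (j, ⟨k, fun i => z (j, i)⟩) τ) w)
      (scrambleArray σ w) := by
  intro j' k' hk'
  simp only [scrambleArray, scrambleDigits]
  rw [Function.update_of_ne]
  intro h'
  simp only [Prod.mk.injEq, Sigma.mk.injEq] at h'
  obtain ⟨rfl, rfl, h'⟩ := h'
  rcases h with h | ⟨i, hi, hne⟩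
  · omega
  · exact hne (congrFun (eq_of_heq h') ⟨i, hi⟩).symm

/-- A function of pure level is uncorrelated with functions of smaller level, and with functions
of the same level evaluated at points that are far apart. -/
lemma integral_mul_eq_zero {b d : ℕ} [NeZero b] {l l' : Fin d → ℕ}
    {G H : (Fin d × ℕ → Fin b) → ℝ} (hG : G ∈ levelSpace b Finset.univ l)
    (hH : ∀ z w, AgreeBelow l' z w → H z = H w) (z w : Fin d × ℕ → Fin b) (j : Fin d)
    (hj : 0 < l j) (h : l' j ≤ l j - 1 ∨ ∃ i < l j - 1, z (j, i) ≠ w (j, i)) :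
    ∫ σ, G (scrambleArray σ z) * H (scrambleArray σ w) ∂familyMeasure b d = 0 := by
  have hb : (b : ℝ) ≠ 0 := by exact_mod_cast NeZero.ne b
  set k := l j - 1 with hk
  have hGm := measurable_of_agreeBelow hG.1
  have hHm := measurable_of_agreeBelow hH
  have hGi (c : Fin b) (z w : Fin d × ℕ → Fin b) : AgreeBelow l z w →
      G (shiftDigit (j, k) c z) = G (shiftDigit (j, k) c w) := by
    intro hzw
    have : z (j, k) = w (j, k) := hzw j k (by omega)
    unfold shiftDigit
    rw [this]
    exact hG.1 _ _ (hzw.update _ _)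
  have hint (c : Fin b) : Integrable
      (fun σ => G (shiftDigit (j, k) c (scrambleArray σ z)) * H (scrambleArray σ w))
      (familyMeasure b d) :=
    (memLp_comp_scrambleArray (memLp_of_agreeBelow (hGi c)) z).integrable_mul
      (memLp_comp_scrambleArray (memLp_of_agreeBelow hH) w)
  -- Translating by `c` the permutation that `z` meets at depth `k` shifts digit `k` of the
  -- scrambled `z` and leaves unchanged whatever `H` reads of the scrambled `w`. Summing over `c`
  -- then produces the vanishing average of `G`.
  have hinv (c : Fin b) :
      ∫ σ, G (scrambleArray σ z) * H (scrambleArray σ w) ∂familyMeasure b d =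
      ∫ σ, G (shiftDigit (j, k) c (scrambleArray σ z)) * H (scrambleArray σ w)
        ∂familyMeasure b d := by
    conv_lhs => rw [← map_update_mul (j, ⟨k, fun i => z (j, i)⟩) (Equiv.addRight c)]
    rw [integral_map (measurable_update_mul _ _).aemeasurable]
    · refine integral_congr_ae (Filter.Eventually.of_forall fun σ => ?_)
      simp only
      rw [scrambleArray_update, hH _ _ (agreeBelow_scrambleArray_update σ z w j k _ h)]
    · exact ((hGm.comp (measurable_scrambleArray z)).mul
        (hHm.comp (measurable_scrambleArray w))).aestronglyMeasurable
  have hsum : (b : ℝ) * ∫ σ, G (scrambleArray σ z) * H (scrambleArray σ w) ∂familyMeasure b d =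
      0 := by
    calc (b : ℝ) * ∫ σ, G (scrambleArray σ z) * H (scrambleArray σ w) ∂familyMeasure b d
        = ∑ c : Fin b, ∫ σ, G (shiftDigit (j, k) c (scrambleArray σ z)) * H (scrambleArray σ w)
          ∂familyMeasure b d := by
          rw [← Finset.sum_congr rfl fun c _ => hinv c]
          simp
      _ = ∫ σ, ∑ c : Fin b, G (shiftDigit (j, k) c (scrambleArray σ z)) * H (scrambleArray σ w)
          ∂familyMeasure b d := (integral_finsetSum _ fun c _ => hint c).symm
      _ = 0 := by
          refine (integral_congr_ae (Filter.Eventually.of_forall fun σ => ?_)).trans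
            (integral_zero _ _)
          have h0 := congrFun (hG.2 j (Finset.mem_univ j) hj) (scrambleArray σ z)
          rw [avgDigit_apply] at h0
          have h0 := (mul_eq_zero.1 h0).resolve_left (inv_ne_zero hb)
          simp only [← Finset.sum_mul]
          rw [hk, h0, zero_mul]
  exact (mul_eq_zero.1 hsum).resolve_left hb

/-- In a coordinate where the levels differ, the function of larger level has a last digit that the
other does not read. -/
lemma integral_mul_eq_zero_of_ne {b d : ℕ} [NeZero b] {l l' : Fin d → ℕ} (hl : l ≠ l')
    {G H : (Fin d × ℕ → Fin b) → ℝ} (hG : G ∈ levelSpace b Finset.univ l)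
    (hH : H ∈ levelSpace b Finset.univ l') (z w : Fin d × ℕ → Fin b) :
    ∫ σ, G (scrambleArray σ z) * H (scrambleArray σ w) ∂familyMeasure b d = 0 := by
  obtain ⟨j, hj⟩ := Function.ne_iff.1 hl
  rcases Nat.lt_or_gt_of_ne hj with h | h
  · simp only [mul_comm (G _)]
    exact integral_mul_eq_zero hH hG.1 w z j (by omega) (Or.inl (by omega))
  · exact integral_mul_eq_zero hG hH.1 z w j (by omega) (Or.inl (by omega))

/-! ### Variance bounds for functions of finitely many digits -/

lemma exists_le_sum_eq {ι : Type*} [Fintype ι] (κ : ι → ℕ) (L : ℕ) (h : L ≤ ∑ j, κ j) :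
    ∃ κ' ≤ κ, ∑ j, κ' j = L := by
  classical
  obtain ⟨r, hr⟩ := Nat.exists_eq_add_of_le h
  induction r generalizing κ with
  | zero => exact ⟨κ, le_rfl, hr⟩
  | succ r ih =>
    obtain ⟨j, -, hj⟩ : ∃ j ∈ Finset.univ, κ j ≠ 0 :=
      Finset.exists_ne_zero_of_sum_ne_zero (by omega)
    have hsum : ∑ i, Function.update κ j (κ j - 1) i = L + r := by
      rw [Finset.sum_update_of_mem (Finset.mem_univ _), Finset.sdiff_singleton_eq_erase]
      have := Finset.add_sum_erase Finset.univ κ (Finset.mem_univ j)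
      omega
    obtain ⟨κ', hκ', h'⟩ := ih _ (by omega) hsum
    refine ⟨κ', hκ'.trans fun i => ?_, h'⟩
    rcases eq_or_ne i j with rfl | hij
    · simp
    · simp [hij]

-- If `κ` has total at least `L`, it is coarsened to total `L`; otherwise at most `d` digits are
-- missing, each costing a factor `b`.
open Classical in
lemma card_agreeBelow_le {b d N : ℕ} [NeZero b] (hd : 0 < d) {z : Fin N → Fin d × ℕ → Fin b}
    {L C : ℕ} (hz : ∀ l : Fin d → ℕ, ∑ j, l j = L → Equidistributed z l C) {κ : Fin d → ℕ}
    (hκ : L ≤ ∑ j, κ j + d) (s : Fin d × ℕ → Fin b) :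
    (Finset.univ.filter fun n => AgreeBelow κ (z n) s).card ≤ b ^ d * C := by
  have hb : 0 < b := NeZero.pos b
  rcases le_total L (∑ j, κ j) with h | h
  · obtain ⟨κ', hle, hsum⟩ := exists_le_sum_eq κ L h
    calc (Finset.univ.filter fun n => AgreeBelow κ (z n) s).card
        ≤ (Finset.univ.filter fun n => AgreeBelow κ' (z n) s).card :=
          Finset.card_le_card fun n hn => by
            simp only [Finset.mem_filter, Finset.mem_univ, true_and] at hn ⊢
            exact hn.mono hle
      _ = C := hz κ' hsum s
      _ ≤ b ^ d * C := Nat.le_mul_of_pos_left _ (by positivity)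
  · obtain ⟨r, hr⟩ := Nat.exists_eq_add_of_le h
    rw [Equidistributed.of_sum_le hd hz r κ hr.symm s]
    exact Nat.mul_le_mul_right _ (Nat.pow_le_pow_right hb (by omega))

lemma integral_mul_le_integral_sq {b d : ℕ} [NeZero b] {G : (Fin d × ℕ → Fin b) → ℝ}
    (hG : MemLp G 2 (arrayMeasure b d)) (z w : Fin d × ℕ → Fin b) :
    ∫ σ, G (scrambleArray σ z) * G (scrambleArray σ w) ∂familyMeasure b d ≤
      ∫ v, G v ^ 2 ∂arrayMeasure b d := by
  have h1 := memLp_comp_scrambleArray hG z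
  have h2 := memLp_comp_scrambleArray hG w
  have hsq (z : Fin d × ℕ → Fin b) :
      ∫ σ, G (scrambleArray σ z) ^ 2 ∂familyMeasure b d = ∫ v, G v ^ 2 ∂arrayMeasure b d :=
    integral_comp_scrambleArray (G := fun v => G v ^ 2) (hG.aestronglyMeasurable.pow 2) z
  calc ∫ σ, G (scrambleArray σ z) * G (scrambleArray σ w) ∂familyMeasure b d
      ≤ ∫ σ, (G (scrambleArray σ z) ^ 2 + G (scrambleArray σ w) ^ 2) / 2 ∂familyMeasure b d := by
        refine integral_mono (h1.integrable_mul h2)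
          ((h1.integrable_sq.add h2.integrable_sq).div_const 2) fun σ => ?_
        simp only
        nlinarith [sq_nonneg (G (scrambleArray σ z) - G (scrambleArray σ w))]
    _ = ∫ v, G v ^ 2 ∂arrayMeasure b d := by
        rw [integral_div, integral_add h1.integrable_sq h2.integrable_sq, hsq, hsq]
        ring

/-- The second moment of the sum of a function of pure nonzero level over a scrambled net. -/
lemma integral_sum_sq_le {b d N : ℕ} [NeZero b] {z : Fin N → Fin d × ℕ → Fin b}
    {L C : ℕ} (hC : C ≠ 0) (hz : ∀ l : Fin d → ℕ, ∑ j, l j = L → Equidistributed z l C)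
    {l : Fin d → ℕ} (hl : l ≠ 0) {G : (Fin d × ℕ → Fin b) → ℝ}
    (hG : G ∈ levelSpace b Finset.univ l) :
    ∫ σ, (∑ n, G (scrambleArray σ (z n))) ^ 2 ∂familyMeasure b d ≤
      ((b ^ d * C : ℕ) : ℝ) * N * ∫ v, G v ^ 2 ∂arrayMeasure b d := by
  classical
  have hI : 0 ≤ ∫ v, G v ^ 2 ∂arrayMeasure b d := integral_nonneg fun _ => sq_nonneg _
  have hd : 0 < d := by
    obtain ⟨j, -⟩ := Function.ne_iff.1 hl
    exact Fin.pos j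
  have hG2 := memLp_of_agreeBelow hG.1
  rcases le_total (∑ j, l j) L with h | h
  · obtain ⟨r, hr⟩ := Nat.exists_eq_add_of_le h
    have heq := Equidistributed.of_sum_le hd hz r l hr.symm
    have h0 (σ : Fin d × Prefix b → Equiv.Perm (Fin b)) :
        ∑ n, G (scrambleArray σ (z n)) = 0 :=
      (heq.scramble σ).sum_eq_zero (mul_ne_zero (pow_ne_zero _ (NeZero.ne b)) hC) hG hl
    simp only [h0]
    simp only [ne_eq, OfNat.ofNat_ne_zero, not_false_eq_true, zero_pow, integral_zero]
    positivity
  -- Two points that already differ below `κ` are uncorrelated. Dropping one digit per coordinate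
  -- lowers the total by at most `d`.
  · set κ : Fin d → ℕ := fun j => l j - 1 with hκ
    have hκL : L ≤ ∑ j, κ j + d := by
      have : ∑ j, l j ≤ ∑ j, (κ j + 1) := Finset.sum_le_sum fun j _ => by simp only [hκ]; omega
      rw [Finset.sum_add_distrib] at this
      simp only [Finset.sum_const, Finset.card_univ, Fintype.card_fin, smul_eq_mul, mul_one] at this
      omega
    have hterm (n n' : Fin N) :
        ∫ σ, G (scrambleArray σ (z n)) * G (scrambleArray σ (z n')) ∂familyMeasure b d ≤
          if AgreeBelow κ (z n') (z n) then ∫ v, G v ^ 2 ∂arrayMeasure b d else 0 := by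
      split_ifs with hag
      · exact integral_mul_le_integral_sq hG2 _ _
      · refine le_of_eq ?_
        simp only [AgreeBelow, not_forall, exists_prop] at hag
        obtain ⟨j, k, hk, hne⟩ := hag
        simp only [hκ] at hk
        exact integral_mul_eq_zero hG hG.1 (z n) (z n') j (by omega)
          (Or.inr ⟨k, hk, Ne.symm hne⟩)
    have hint (n n' : Fin N) : Integrable
        (fun σ => G (scrambleArray σ (z n)) * G (scrambleArray σ (z n'))) (familyMeasure b d) :=
      (memLp_comp_scrambleArray hG2 _).integrable_mul (memLp_comp_scrambleArray hG2 _)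
    calc ∫ σ, (∑ n, G (scrambleArray σ (z n))) ^ 2 ∂familyMeasure b d
        = ∑ n, ∑ n', ∫ σ, G (scrambleArray σ (z n)) * G (scrambleArray σ (z n'))
            ∂familyMeasure b d := by
          simp only [sq, Finset.sum_mul_sum]
          rw [integral_finsetSum _ fun n _ => integrable_finsetSum _ fun n' _ => hint n n']
          exact Finset.sum_congr rfl fun n _ => integral_finsetSum _ fun n' _ => hint n n'
      _ ≤ ∑ n : Fin N, ∑ n', if AgreeBelow κ (z n') (z n) then
            ∫ v, G v ^ 2 ∂arrayMeasure b d else 0 :=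
          Finset.sum_le_sum fun n _ => Finset.sum_le_sum fun n' _ => hterm n n'
      _ ≤ ∑ n : Fin N, ((b ^ d * C : ℕ) : ℝ) * ∫ v, G v ^ 2 ∂arrayMeasure b d := by
          refine Finset.sum_le_sum fun n _ => ?_
          rw [← Finset.sum_filter, Finset.sum_const, nsmul_eq_mul]
          refine mul_le_mul_of_nonneg_right ?_ hI
          exact_mod_cast card_agreeBelow_le hd hz hκL (z n)
      _ = ((b ^ d * C : ℕ) : ℝ) * N * ∫ v, G v ^ 2 ∂arrayMeasure b d := by
          simp only [Finset.sum_const, Finset.card_univ, Fintype.card_fin, nsmul_eq_mul]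
          ring

/-- The second moment of a sum of pairwise orthogonal random variables. -/
lemma integral_sum_sq_of_orthogonal {Ω ι : Type*} [MeasurableSpace Ω] {μ : Measure Ω}
    (F : Finset ι) {X : ι → Ω → ℝ} (hX : ∀ i ∈ F, MemLp (X i) 2 μ)
    (h : ∀ i ∈ F, ∀ i' ∈ F, i ≠ i' → ∫ ω, X i ω * X i' ω ∂μ = 0) :
    ∫ ω, (∑ i ∈ F, X i ω) ^ 2 ∂μ = ∑ i ∈ F, ∫ ω, X i ω ^ 2 ∂μ := by
  classical
  have hint : ∀ i ∈ F, ∀ i' ∈ F, Integrable (fun ω => X i ω * X i' ω) μ :=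
    fun i hi i' hi' => (hX i hi).integrable_mul (hX i' hi')
  simp only [sq, Finset.sum_mul_sum]
  rw [integral_finsetSum _ fun i hi => integrable_finsetSum _ fun i' hi' => hint i hi i' hi']
  refine Finset.sum_congr rfl fun i hi => ?_
  rw [integral_finsetSum _ fun i' hi' => hint i hi i' hi']
  exact Finset.sum_eq_single_of_mem i hi fun i' hi' hne => h i hi i' hi' hne.symm

lemma variance_le_integral_sub_sq {Ω : Type*} [MeasurableSpace Ω] {μ : Measure Ω}
    [IsProbabilityMeasure μ] {X : Ω → ℝ} (hX : AEStronglyMeasurable X μ) (c : ℝ) :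
    Var[X; μ] ≤ ∫ ω, (X ω - c) ^ 2 ∂μ := by
  rw [← variance_sub_const hX c]
  exact variance_le_expectation_sq (hX.sub aestronglyMeasurable_const)

/-- The variance of the sum over a scrambled net of a function of finitely many digits. -/
lemma variance_sum_le {b d N : ℕ} [NeZero b] {z : Fin N → Fin d × ℕ → Fin b}
    {L C : ℕ} (hC : C ≠ 0) (hz : ∀ l : Fin d → ℕ, ∑ j, l j = L → Equidistributed z l C)
    {l : Fin d → ℕ} {G : (Fin d × ℕ → Fin b) → ℝ} (hG : ∀ z w, AgreeBelow l z w → G z = G w) :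
    Var[fun σ => ∑ n, G (scrambleArray σ (z n)); familyMeasure b d] ≤
      ((b ^ d * C : ℕ) : ℝ) * N * ∫ v, G v ^ 2 ∂arrayMeasure b d := by
  classical
  obtain ⟨F, g, hF, rfl⟩ := exists_eq_sum_levelSpace hG
  have hg2 : ∀ l' ∈ F, MemLp (g l') 2 (arrayMeasure b d) :=
    fun l' hl' => memLp_of_agreeBelow (hF l' hl').2.1
  set X : (Fin d → ℕ) → (Fin d × Prefix b → Equiv.Perm (Fin b)) → ℝ :=
    fun l' σ => ∑ n, g l' (scrambleArray σ (z n)) with hX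
  have hX2 : ∀ l' ∈ F, MemLp (X l') 2 (familyMeasure b d) := fun l' hl' =>
    memLp_finsetSum _ fun n _ => memLp_comp_scrambleArray (hg2 l' hl') (z n)
  have hsum (σ : Fin d × Prefix b → Equiv.Perm (Fin b)) :
      ∑ n, (∑ l' ∈ F, g l') (scrambleArray σ (z n)) = ∑ l' ∈ F, X l' σ := by
    simp only [Finset.sum_apply, hX]
    exact Finset.sum_comm
  simp only [hsum]
  -- The level 0 piece reads no digit: it contributes a constant, which the variance ignores.
  obtain ⟨c, hc⟩ : ∃ c, ∀ σ, ∑ l' ∈ F, X l' σ - c = ∑ l' ∈ F.erase 0, X l' σ := by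
    by_cases h0 : (0 : Fin d → ℕ) ∈ F
    · refine ⟨∑ n : Fin N, g 0 fun _ => 0, fun σ => ?_⟩
      rw [← Finset.add_sum_erase F _ h0, sub_eq_iff_eq_add, add_comm]
      congr 1
      exact Finset.sum_congr rfl fun n _ =>
        (hF 0 h0).2.1 _ _ fun j k hk => absurd hk (Nat.not_lt_zero k)
    · exact ⟨0, fun σ => by rw [Finset.erase_eq_of_notMem h0, sub_zero]⟩
  have horth : ∀ i ∈ F, ∀ i' ∈ F, i ≠ i' →
      ∫ σ, X i σ * X i' σ ∂familyMeasure b d = 0 := by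
    intro i hi i' hi' hne
    have hint (n n' : Fin N) : Integrable
        (fun σ => g i (scrambleArray σ (z n)) * g i' (scrambleArray σ (z n')))
        (familyMeasure b d) :=
      (memLp_comp_scrambleArray (hg2 i hi) _).integrable_mul
        (memLp_comp_scrambleArray (hg2 i' hi') _)
    simp only [hX, Finset.sum_mul_sum]
    rw [integral_finsetSum _ fun n _ => integrable_finsetSum _ fun n' _ => hint n n']
    refine Finset.sum_eq_zero fun n _ => ?_
    rw [integral_finsetSum _ fun n' _ => hint n n']
    exact Finset.sum_eq_zero fun n' _ =>
      integral_mul_eq_zero_of_ne hne (hF i hi).2 (hF i' hi').2 _ _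
  -- Pythagoras for the levels: a scrambled fixed array has law `arrayMeasure`, so the orthogonality
  -- lemma applies with both points equal to the zero array.
  have hnorm : ∫ v, (∑ l' ∈ F, g l') v ^ 2 ∂arrayMeasure b d =
      ∑ l' ∈ F, ∫ v, g l' v ^ 2 ∂arrayMeasure b d := by
    have hm (h : (Fin d × ℕ → Fin b) → ℝ) (hh : MemLp h 2 (arrayMeasure b d)) :
        ∫ v, h v ^ 2 ∂arrayMeasure b d =
        ∫ σ, h (scrambleArray σ fun _ => 0) ^ 2 ∂familyMeasure b d :=
      (integral_comp_scrambleArray (G := fun v => h v ^ 2)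
        (hh.aestronglyMeasurable.pow 2) _).symm
    rw [hm _ (memLp_finsetSum' _ hg2), Finset.sum_congr rfl fun l' hl' => hm _ (hg2 l' hl')]
    simp only [Finset.sum_apply]
    exact integral_sum_sq_of_orthogonal F
      (fun i hi => memLp_comp_scrambleArray (hg2 i hi) _)
      fun i hi i' hi' hne => integral_mul_eq_zero_of_ne hne (hF i hi).2 (hF i' hi').2 _ _
  calc Var[fun σ => ∑ l' ∈ F, X l' σ; familyMeasure b d]
      ≤ ∫ σ, (∑ l' ∈ F, X l' σ - c) ^ 2 ∂familyMeasure b d :=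
        variance_le_integral_sub_sq (memLp_finsetSum _ hX2).aestronglyMeasurable c
    _ = ∑ l' ∈ F.erase 0, ∫ σ, X l' σ ^ 2 ∂familyMeasure b d := by
        simp only [hc]
        exact integral_sum_sq_of_orthogonal _ (fun i hi => hX2 i (Finset.mem_of_mem_erase hi))
          fun i hi i' hi' => horth i (Finset.mem_of_mem_erase hi) i' (Finset.mem_of_mem_erase hi')
    _ ≤ ∑ l' ∈ F.erase 0,
          ((b ^ d * C : ℕ) : ℝ) * N * ∫ v, g l' v ^ 2 ∂arrayMeasure b d :=
        Finset.sum_le_sum fun l' hl' => integral_sum_sq_le hC hz (Finset.ne_of_mem_erase hl')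
          (hF l' (Finset.mem_of_mem_erase hl')).2
    _ ≤ ∑ l' ∈ F, ((b ^ d * C : ℕ) : ℝ) * N * ∫ v, g l' v ^ 2 ∂arrayMeasure b d :=
        Finset.sum_le_sum_of_subset_of_nonneg (Finset.erase_subset _ _) fun l' _ _ =>
          mul_nonneg (by positivity) (integral_nonneg fun _ => sq_nonneg _)
    _ = _ := by rw [← Finset.mul_sum, hnorm]

/-- Scrambled nets integrate exactly the functions of few digits. -/
lemma exists_sum_eq_const {b d N : ℕ} [NeZero b] {z : Fin N → Fin d × ℕ → Fin b}
    {L C : ℕ} (hC : C ≠ 0) (hz : ∀ l : Fin d → ℕ, ∑ j, l j = L → Equidistributed z l C)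
    {l : Fin d → ℕ} (hl : ∑ j, l j ≤ L) {G : (Fin d × ℕ → Fin b) → ℝ}
    (hG : ∀ z w, AgreeBelow l z w → G z = G w) :
    ∃ c, ∀ σ, ∑ n, G (scrambleArray σ (z n)) = c := by
  classical
  obtain ⟨F, g, hF, rfl⟩ := exists_eq_sum_levelSpace hG
  refine ⟨∑ l' ∈ F, if l' = 0 then ∑ n : Fin N, g l' fun _ => 0 else 0, fun σ => ?_⟩
  simp only [Finset.sum_apply]
  rw [Finset.sum_comm]
  refine Finset.sum_congr rfl fun l' hl' => ?_
  split_ifs with h0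
  · subst h0
    exact Finset.sum_congr rfl fun n _ =>
      (hF 0 hl').2.1 _ _ fun j k hk => absurd hk (Nat.not_lt_zero k)
  · have hd : 0 < d := by
      obtain ⟨j, -⟩ := Function.ne_iff.1 h0
      exact Fin.pos j
    obtain ⟨r, hr⟩ := Nat.exists_eq_add_of_le
      ((Finset.sum_le_sum fun j _ => (hF l' hl').1 j).trans hl)
    exact ((Equidistributed.of_sum_le hd hz r l' hr.symm).scramble σ).sum_eq_zero
      (mul_ne_zero (pow_ne_zero _ (NeZero.ne b)) hC) (hF l' hl').2 h0

/-! ### Square integrable functions -/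

lemma integral_sq_le_of_eLpNorm_le {α : Type*} [MeasurableSpace α] {μ : Measure α} {f : α → ℝ}
    (hf : MemLp f 2 μ) {r : ℝ} (hr : 0 ≤ r) (h : eLpNorm f 2 μ ≤ ENNReal.ofReal r) :
    ∫ x, f x ^ 2 ∂μ ≤ r ^ 2 := by
  have h1 := hf.eLpNorm_eq_integral_rpow_norm (by norm_num) (by norm_num)
  rw [h1, ENNReal.ofReal_le_ofReal_iff hr] at h
  have h0 : 0 ≤ ∫ x, f x ^ 2 ∂μ := integral_nonneg fun _ => sq_nonneg _
  have h2 : (∫ x, ‖f x‖ ^ (2 : ENNReal).toReal ∂μ) = ∫ x, f x ^ 2 ∂μ := by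
    simp
  rw [h2] at h
  have h3 : √(∫ x, f x ^ 2 ∂μ) ≤ r := by
    rw [Real.sqrt_eq_rpow]
    simpa using h
  exact (Real.sqrt_le_left hr).1 h3

/-- The functions of finitely many digits are dense in `L²`. -/
lemma exists_agreeBelow_integral_sub_sq_le {b d : ℕ} [NeZero b] (hb : 2 ≤ b)
    {φ : (Fin d → ℝ) → ℝ} (hφ : MemLp φ 2 (cubeMeasure d)) {η : ℝ} (hη : 0 < η) :
    ∃ (K : ℕ) (G : (Fin d × ℕ → Fin b) → ℝ),
      (∀ z w, AgreeBelow (fun _ => K) z w → G z = G w) ∧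
      ∫ z, (φ (toPoint z) - G z) ^ 2 ∂arrayMeasure b d ≤ η := by
  have hb1 : (1 : ℝ) < b := by exact_mod_cast hb
  -- Two errors of mean square at most `η / 4`, combined by (x + y)² ≤ 2x² + 2y², give `η`.
  set r : ℝ := √(η / 4) with hr
  have hr0 : 0 < r := Real.sqrt_pos.2 (by positivity)
  have hr2 : r ^ 2 = η / 4 := Real.sq_sqrt (by positivity)
  have : (cubeMeasure d).Regular := by
    unfold cubeMeasure
    have : IsFiniteMeasure ((volume : Measure (Fin d → ℝ)).restrict (Set.Icc 0 1)) :=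
      ⟨by simpa using isCompact_Icc.measure_lt_top⟩
    infer_instance
  obtain ⟨h, -, hle, hcont, hmem⟩ := hφ.exists_hasCompactSupport_eLpNorm_sub_le
    (by norm_num) (ε := ENNReal.ofReal r) (by simpa using hr0)
  obtain ⟨δ, hδ, huc⟩ := Metric.uniformContinuousOn_iff.1
    (isCompact_Icc.uniformContinuousOn_of_continuous
      (hcont.continuousOn (s := Set.Icc (0 : Fin d → ℝ) 1))) r hr0
  obtain ⟨K, hK⟩ := exists_pow_lt_of_lt_one hδ (inv_lt_one_of_one_lt₀ hb1)
  -- Truncation moves each coordinate by at most b^(-K) < δ, so uniform continuity of `h` on the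
  -- cube controls the error.
  let T : (Fin d × ℕ → Fin b) → Fin d × ℕ → Fin b := fun z i => if i.2 < K then z i else 0
  have hG : ∀ z w, AgreeBelow (fun _ => K) z w → h (toPoint (T z)) = h (toPoint (T w)) := by
    intro z w hzw
    congr 2
    ext1 ⟨j, k⟩
    simp only [T]
    split_ifs with hk
    · exact hzw j k hk
    · rfl
  have hclose (z : Fin d × ℕ → Fin b) : (h (toPoint z) - h (toPoint (T z))) ^ 2 ≤ η / 4 := by
    have h1 : dist (toPoint z) (toPoint (T z)) < δ := by
      rw [dist_pi_lt_iff hδ]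
      intro j
      rw [Real.dist_eq]
      refine (Real.abs_ofDigits_sub_ofDigits_le (n := K) fun i hi => ?_).trans_lt
        (by rwa [← inv_pow])
      simp [T, hi]
    have h2 := huc _ (toPoint_mem_Icc z) _ (toPoint_mem_Icc (T z)) h1
    rw [Real.dist_eq] at h2
    rw [← hr2, ← sq_abs]
    exact pow_le_pow_left₀ (abs_nonneg _) h2.le 2
  have hdiff : MemLp (φ - h) 2 (cubeMeasure d) := hφ.sub hmem
  have hdiff' : MemLp (fun z => φ (toPoint z) - h (toPoint z)) 2 (arrayMeasure b d) := by
    rw [← map_toPoint hb] at hdiff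
    exact hdiff.comp_of_map (measurable_toPoint b d).aemeasurable
  have h1 : ∫ z, (φ (toPoint z) - h (toPoint z)) ^ 2 ∂arrayMeasure b d ≤ η / 4 := by
    rw [← hr2, ← integral_map (f := fun x => (φ x - h x) ^ 2)
      (measurable_toPoint b d).aemeasurable, map_toPoint hb]
    · exact integral_sq_le_of_eLpNorm_le hdiff hr0.le hle
    · rw [map_toPoint hb]
      exact hdiff.aestronglyMeasurable.pow 2
  have hmem' : MemLp (fun z => h (toPoint z)) 2 (arrayMeasure b d) := by
    rw [← map_toPoint hb] at hmem
    exact hmem.comp_of_map (measurable_toPoint b d).aemeasurable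
  have hGm := memLp_of_agreeBelow hG
  refine ⟨K, fun z => h (toPoint (T z)), hG, ?_⟩
  calc ∫ z, (φ (toPoint z) - h (toPoint (T z))) ^ 2 ∂arrayMeasure b d
      ≤ ∫ z, (2 * (φ (toPoint z) - h (toPoint z)) ^ 2 + 2 * (η / 4)) ∂arrayMeasure b d := by
        refine integral_mono ((hdiff'.add (hmem'.sub hGm)).integrable_sq.congr
          (Filter.Eventually.of_forall fun z => ?_))
          ((hdiff'.integrable_sq.const_mul 2).add (integrable_const _)) fun z => ?_
        · simp
        · have := hclose z
          simp only
          nlinarith [sq_nonneg ((φ (toPoint z) - h (toPoint z)) -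
            (h (toPoint z) - h (toPoint (T z))))]
    _ ≤ η := by
        rw [integral_add (hdiff'.integrable_sq.const_mul 2) (integrable_const _),
          integral_const_mul]
        simp
        linarith

/-- A quantitative form of the convergence theorem for scrambled nets: with `V` the variance of
the sum over `N` points, `V ≤ N * η` as soon as the level `L` of equidistribution is large. -/
lemma variance_sum_scrambled_le {b d : ℕ} [NeZero b] (hb : 2 ≤ b)
    {φ : (Fin d → ℝ) → ℝ} (hφ : MemLp φ 2 (cubeMeasure d)) (B : ℝ) {η : ℝ} (hη : 0 < η) :
    ∃ L₀ : ℕ, ∀ (N L C : ℕ) (z : Fin N → Fin d × ℕ → Fin b), 0 < N → L₀ ≤ L → C ≠ 0 →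
      ((b ^ d * C : ℕ) : ℝ) ≤ B →
      (∀ l : Fin d → ℕ, ∑ j, l j = L → Equidistributed z l C) →
      Var[fun σ => ∑ n, φ (toPoint (scrambleArray σ (z n))); familyMeasure b d] ≤
        N * ((8 * B + 2) * η) := by
  -- `G₁` is fixed before `N`; its level has total `d * K₁`, so its sum over the net is constant as
  -- soon as `L` reaches that total.
  obtain ⟨K₁, G₁, hG₁, hle₁⟩ := exists_agreeBelow_integral_sub_sq_le hb hφ hη
  refine ⟨d * K₁, fun N L C z hN hL hC hB hz => ?_⟩
  have hN' : (0 : ℝ) < N := by exact_mod_cast hN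
  -- The accuracy `η / N` compensates for the factor `N` lost by Cauchy–Schwarz in `hRsq`. The
  -- number `K₂` of digits may depend on `N`, since `variance_sum_le` is uniform in the level.
  obtain ⟨K₂, G₂, hG₂, hle₂⟩ := exists_agreeBelow_integral_sub_sq_le hb hφ (div_pos hη hN')
  have hΦ : MemLp (fun z => φ (toPoint z)) 2 (arrayMeasure b d) := by
    rw [← map_toPoint hb] at hφ
    exact hφ.comp_of_map (measurable_toPoint b d).aemeasurable
  have hm₁ := memLp_of_agreeBelow hG₁
  have hm₂ := memLp_of_agreeBelow hG₂
  obtain ⟨c, hc⟩ := exists_sum_eq_const hC hz (l := fun _ => K₁) (by simpa using hL) hG₁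
  have hdep : ∀ z w, AgreeBelow (fun _ => max K₁ K₂) z w → (G₂ - G₁) z = (G₂ - G₁) w := by
    intro z w h
    rw [Pi.sub_apply, Pi.sub_apply, hG₁ z w (h.mono fun _ => le_max_left _ _),
      hG₂ z w (h.mono fun _ => le_max_right _ _)]
  set X : (Fin d × Prefix b → Equiv.Perm (Fin b)) → ℝ :=
    fun σ => ∑ n, (G₂ - G₁) (scrambleArray σ (z n)) with hX
  set R : (Fin d × Prefix b → Equiv.Perm (Fin b)) → ℝ :=
    fun σ => ∑ n, (φ (toPoint (scrambleArray σ (z n))) - G₂ (scrambleArray σ (z n))) with hR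
  have hdm : MemLp (fun z => φ (toPoint z) - G₂ z) 2 (arrayMeasure b d) := hΦ.sub hm₂
  have hXm : MemLp X 2 (familyMeasure b d) := memLp_finsetSum _ fun n _ =>
    memLp_comp_scrambleArray (hm₂.sub hm₁) (z n)
  have hRm : MemLp R 2 (familyMeasure b d) := memLp_finsetSum _ fun n _ =>
    memLp_comp_scrambleArray hdm (z n)
  have hdecomp (σ : Fin d × Prefix b → Equiv.Perm (Fin b)) :
      ∑ n, φ (toPoint (scrambleArray σ (z n))) = c + X σ + R σ := by
    rw [← hc σ, hX, hR]
    simp only [Pi.sub_apply, Finset.sum_sub_distrib]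
    ring
  have hnorm : ∫ v, (G₂ - G₁) v ^ 2 ∂arrayMeasure b d ≤ 4 * η := by
    have h1 : Integrable (fun v => (φ (toPoint v) - G₁ v) ^ 2) (arrayMeasure b d) :=
      (hΦ.sub hm₁).integrable_sq
    have h2 : Integrable (fun v => (φ (toPoint v) - G₂ v) ^ 2) (arrayMeasure b d) :=
      hdm.integrable_sq
    have hη2 : η / N ≤ η := div_le_self hη.le (by exact_mod_cast hN)
    calc ∫ v, (G₂ - G₁) v ^ 2 ∂arrayMeasure b d
        ≤ ∫ v, (2 * (φ (toPoint v) - G₁ v) ^ 2 + 2 * (φ (toPoint v) - G₂ v) ^ 2)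
            ∂arrayMeasure b d := by
          refine integral_mono (hm₂.sub hm₁).integrable_sq
            ((h1.const_mul 2).add (h2.const_mul 2)) fun v => ?_
          simp only [Pi.sub_apply]
          nlinarith [sq_nonneg ((φ (toPoint v) - G₁ v) + (φ (toPoint v) - G₂ v))]
      _ ≤ 4 * η := by
          rw [integral_add (h1.const_mul 2) (h2.const_mul 2), integral_const_mul,
            integral_const_mul]
          linarith
  have hXvar : Var[X; familyMeasure b d] ≤ B * N * (4 * η) := by
    refine (variance_sum_le hC hz hdep).trans ?_
    have : 0 ≤ ∫ v, (G₂ - G₁) v ^ 2 ∂arrayMeasure b d := integral_nonneg fun _ => sq_nonneg _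
    have hB0 : 0 ≤ B := le_trans (Nat.cast_nonneg _) hB
    exact mul_le_mul (mul_le_mul_of_nonneg_right hB hN'.le) hnorm this (by positivity)
  have hRsq : ∫ σ, R σ ^ 2 ∂familyMeasure b d ≤ N * η := by
    have hi (n : Fin N) : Integrable (fun σ => (φ (toPoint (scrambleArray σ (z n))) -
        G₂ (scrambleArray σ (z n))) ^ 2) (familyMeasure b d) :=
      (memLp_comp_scrambleArray hdm (z n)).integrable_sq
    calc ∫ σ, R σ ^ 2 ∂familyMeasure b d
        ≤ ∫ σ, N * ∑ n, (φ (toPoint (scrambleArray σ (z n))) -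
            G₂ (scrambleArray σ (z n))) ^ 2 ∂familyMeasure b d := by
          refine integral_mono hRm.integrable_sq
            ((integrable_finsetSum _ fun n _ => hi n).const_mul _) fun σ => ?_
          have := sq_sum_le_card_mul_sum_sq (s := (Finset.univ : Finset (Fin N)))
            (f := fun n => φ (toPoint (scrambleArray σ (z n))) - G₂ (scrambleArray σ (z n)))
          rwa [Finset.card_univ, Fintype.card_fin] at this
      _ = N * ∑ n : Fin N, ∫ v, (φ (toPoint v) - G₂ v) ^ 2 ∂arrayMeasure b d := by
          rw [integral_const_mul, integral_finsetSum _ fun n _ => hi n]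
          congr 1
          exact Finset.sum_congr rfl fun n _ => integral_comp_scrambleArray
            (G := fun v => (φ (toPoint v) - G₂ v) ^ 2) (hdm.aestronglyMeasurable.pow 2) (z n)
      _ ≤ N * ∑ n : Fin N, η / N := by gcongr
      _ = N * η := by
          rw [Finset.sum_const, Finset.card_univ, Fintype.card_fin, nsmul_eq_mul,
            mul_div_cancel₀ _ hN'.ne']
  simp only [hdecomp]
  -- Centring at `c + e` leaves twice the variance of `X` plus twice the second moment of `R`: 2 ·
  -- 4Bη + 2η per point.
  set e := ∫ σ, X σ ∂familyMeasure b d with he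
  have hXe : MemLp (fun σ => X σ - e) 2 (familyMeasure b d) := hXm.sub (memLp_const e)
  calc Var[fun σ => c + X σ + R σ; familyMeasure b d]
      ≤ ∫ σ, (c + X σ + R σ - (c + e)) ^ 2 ∂familyMeasure b d :=
        variance_le_integral_sub_sq
          ((aestronglyMeasurable_const.add hXm.aestronglyMeasurable).add
            hRm.aestronglyMeasurable) _
    _ ≤ ∫ σ, (2 * (X σ - e) ^ 2 + 2 * R σ ^ 2) ∂familyMeasure b d := by
        refine integral_mono ((hXe.add hRm).integrable_sq.congr
          (Filter.Eventually.of_forall fun σ => ?_))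
          ((hXe.integrable_sq.const_mul 2).add (hRm.integrable_sq.const_mul 2)) fun σ => ?_
        · simp only [Pi.add_apply]
          ring
        · simp only
          nlinarith [sq_nonneg ((X σ - e) - R σ)]
    _ = 2 * Var[X; familyMeasure b d] + 2 * ∫ σ, R σ ^ 2 ∂familyMeasure b d := by
        rw [integral_add (hXe.integrable_sq.const_mul 2) (hRm.integrable_sq.const_mul 2),
          integral_const_mul, integral_const_mul,
          variance_eq_integral hXm.aestronglyMeasurable.aemeasurable]
    _ ≤ N * ((8 * B + 2) * η) := by
        nlinarith [hXvar, hRsq]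

/-! ### Owen's theorem for scrambled nets -/

/-- Almost surely, the points of a scrambled net have the scrambled digits. -/
lemma IsScrambledNet.exists_family {Ω : Type*} [MeasurableSpace Ω] {μ : Measure Ω}
    [IsProbabilityMeasure μ] {b lam t m d : ℕ} [NeZero b] {N : ℕ} {u : Fin N → Ω → Fin d → ℝ}
    (hu : IsScrambledNet μ b lam t m d u) :
    ∃ (a : Fin N → Fin d → ℝ) (ρ : Ω → Fin d × Prefix b → Equiv.Perm (Fin b)),
      IsNet b lam t m d a ∧ Measurable ρ ∧ μ.map ρ = familyMeasure b d ∧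
      ∀ᵐ ω ∂μ, ∀ n, u n ω = toPoint (scrambleArray (ρ ω) (digitArray b (a n))) := by
  obtain ⟨-, a, π, ha, hπ, hae⟩ := hu
  refine ⟨a, fun ω i => π i ω, ha, measurable_pi_lambda _ hπ.measurable, hπ.map_eq, ?_⟩
  filter_upwards [hae] with ω hω n
  ext j
  exact hω n j

/-- Every point of a scrambled net is uniformly distributed. -/
lemma IsScrambledNet.map_eq {Ω : Type*} [MeasurableSpace Ω] {μ : Measure Ω}
    [IsProbabilityMeasure μ] {b lam t m d : ℕ} [NeZero b] (hb : 2 ≤ b) {N : ℕ}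
    {u : Fin N → Ω → Fin d → ℝ} (hu : IsScrambledNet μ b lam t m d u) (n : Fin N) :
    μ.map (u n) = cubeMeasure d := by
  obtain ⟨a, ρ, -, hρ, hmap, hae⟩ := hu.exists_family
  rw [Measure.map_congr (hae.mono fun ω hω => hω n), ← map_toPoint hb,
    ← map_scrambleArray (digitArray b (a n)), ← hmap,
    Measure.map_map (measurable_scrambleArray _) hρ,
    Measure.map_map (measurable_toPoint b d) ((measurable_scrambleArray _).comp hρ)]
  rfl

/-- **Owen's theorem**: the variance of the average of a square integrable function over a
scrambled net of `N` points is `o(1 / N)`. -/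
theorem variance_average_isLittleO {b d t : ℕ} [NeZero b] (hb : 2 ≤ b)
    {φ : (Fin d → ℝ) → ℝ} (hφ : MemLp φ 2 (cubeMeasure d))
    {N lam m : ℕ → ℕ} (hN : Filter.Tendsto N Filter.atTop Filter.atTop)
    {Ω : ℕ → Type*} [∀ k, MeasurableSpace (Ω k)]
    (μ : ∀ k, Measure (Ω k)) [∀ k, IsProbabilityMeasure (μ k)]
    {u : ∀ k, Fin (N k) → Ω k → Fin d → ℝ}
    (hu : ∀ k, IsScrambledNet (μ k) b (lam k) t (m k) d (u k)) :
    (fun k => Var[fun ω => (1 / (N k : ℝ)) * ∑ n, φ (u k n ω); μ k]) =o[Filter.atTop]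
      fun k => 1 / (N k : ℝ) := by
  rw [Asymptotics.isLittleO_iff]
  intro ε hε
  have hb0 : 0 < b := by omega
  -- Since `lam < b`, this bounds `b ^ d * (lam * b ^ t)` for all nets at once.
  set B : ℝ := ((b ^ d * (b * b ^ t) : ℕ) : ℝ) with hB
  have hB0 : 0 ≤ B := by positivity
  have hη : 0 < ε / (8 * B + 2) := by positivity
  obtain ⟨L₀, hL₀⟩ := variance_sum_scrambled_le hb hφ B hη
  filter_upwards [hN.eventually_ge_atTop (b ^ (L₀ + t + 1))] with k hk
  obtain ⟨a, ρ, ha, hρ, hmap, hae⟩ := (hu k).exists_family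
  have hNpos : 0 < N k := lt_of_lt_of_le (by positivity) hk
  have hNpos' : (0 : ℝ) < N k := by exact_mod_cast hNpos
  -- As `lam < b`, `N < b ^ (m + 1)`: large `N` forces large `m`, whatever `lam` is.
  have hm : L₀ + t ≤ m k := by
    have h1 : b ^ (L₀ + t + 1) < b ^ (m k + 1) := by
      refine hk.trans_lt ?_
      rw [ha.card_eq, pow_succ']
      exact Nat.mul_lt_mul_of_pos_right ha.lam_lt (by positivity)
    have := (Nat.pow_lt_pow_iff_right (by omega)).1 h1
    omega
  have hC : lam k * b ^ t ≠ 0 := by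
    have := ha.one_le_lam
    positivity
  have hvar := hL₀ (N k) (m k - t) (lam k * b ^ t) (fun n => digitArray b (a n)) hNpos
    (by omega) hC (by
      rw [hB]
      exact_mod_cast Nat.mul_le_mul_left _ (Nat.mul_le_mul_right _ ha.lam_lt.le))
    fun l hl => ha.equidistributed l hl
  rw [mul_div_cancel₀ _ (by positivity : (8 * B + 2) ≠ 0)] at hvar
  have hmeas : AEMeasurable (fun σ => ∑ n, φ (toPoint (scrambleArray σ (digitArray b (a n)))))
      (familyMeasure b d) := by
    have hΦ : MemLp (fun z => φ (toPoint z)) 2 (arrayMeasure b d) := by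
      rw [← map_toPoint hb] at hφ
      exact hφ.comp_of_map (measurable_toPoint b d).aemeasurable
    exact (memLp_finsetSum _ fun n _ =>
      memLp_comp_scrambleArray hΦ (digitArray b (a n))).aestronglyMeasurable.aemeasurable
  have heq : Var[fun ω => (1 / (N k : ℝ)) * ∑ n, φ (u k n ω); μ k] =
      (1 / (N k : ℝ)) ^ 2 * Var[fun σ => ∑ n, φ (toPoint (scrambleArray σ (digitArray b (a n))));
        familyMeasure b d] := by
    rw [variance_const_mul]
    congr 1
    rw [← hmap] at hmeas ⊢
    rw [variance_map hmeas hρ.aemeasurable]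
    refine variance_congr ?_
    filter_upwards [hae] with ω hω
    simp [hω]
  rw [Real.norm_of_nonneg (variance_nonneg _ _), Real.norm_of_nonneg (by positivity), heq]
  calc (1 / (N k : ℝ)) ^ 2 * _ ≤ (1 / (N k : ℝ)) ^ 2 * (N k * ε) := by gcongr
    _ = ε * (1 / (N k : ℝ)) := by field_simp

end RQMC

namespace ABC

/-! ### Conditional expectation given the parameters -/

variable {Θ Y : Type*} [MeasurableSpace Θ] [MeasurableSpace Y]

/-- In the joint law, every slot other than `(n, i)` is left free and contributes a factor 1. -/
lemma IsSimulatedData.measure_inter {Ω : Type*} [MeasurableSpace Ω] {μ : Measure Ω}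
    {lik : Kernel Θ Y} [IsMarkovKernel lik] {N M : ℕ} {θ : Fin N → Ω → Θ}
    {y : Fin N → Fin M → Ω → Y} (hy : IsSimulatedData μ lik θ y) (n : Fin N) (i : Fin M)
    {D : Set Y} (hD : MeasurableSet D) {A : Set (Fin N → Θ)} (hA : MeasurableSet A) :
    μ ((fun ω n => θ n ω) ⁻¹' A ∩ y n i ⁻¹' D) =
      ∫⁻ ω in (fun ω n => θ n ω) ⁻¹' A, lik (θ n ω) D ∂μ := by
  classical
  have h := hy.law A (fun n' i' => if n' = n ∧ i' = i then D else Set.univ) hA fun n' i' => by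
    split_ifs
    exacts [hD, MeasurableSet.univ]
  have hset : {ω | (fun n => θ n ω) ∈ A ∧
      ∀ n' i', y n' i' ω ∈ if n' = n ∧ i' = i then D else Set.univ} =
      (fun ω n => θ n ω) ⁻¹' A ∩ y n i ⁻¹' D := by
    ext ω
    refine and_congr_right fun _ => ⟨fun h => by simpa using h n i, fun h n' i' => ?_⟩
    split_ifs with hc
    · obtain ⟨rfl, rfl⟩ := hc
      exact h
    · trivial
  rw [← hset, h]
  refine lintegral_congr fun ω => ?_
  rw [Finset.prod_eq_single n, Finset.prod_eq_single i]
  · simp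
  · intro i' _ hi'
    simp [hi']
  · simp
  · intro n' _ hn'
    simp [hn']
  · simp

/-- Restricted to the event that `y n i` lies in `D`, the law of the parameters acquires the density
`lik (x n) D`. -/
lemma IsSimulatedData.setLIntegral_eq {Ω : Type*} [MeasurableSpace Ω] {μ : Measure Ω}
    {lik : Kernel Θ Y} [IsMarkovKernel lik] {N M : ℕ} {θ : Fin N → Ω → Θ}
    (hθ : ∀ n, Measurable (θ n))
    {y : Fin N → Fin M → Ω → Y} (hy : IsSimulatedData μ lik θ y) (n : Fin N) (i : Fin M)
    {D : Set Y} (hD : MeasurableSet D) {F : (Fin N → Θ) → ENNReal} (hF : Measurable F) :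
    ∫⁻ ω in y n i ⁻¹' D, F (fun n => θ n ω) ∂μ =
      ∫⁻ ω, lik (θ n ω) D * F (fun n => θ n ω) ∂μ := by
  have hv : Measurable fun ω n => θ n ω := measurable_pi_lambda _ hθ
  have hl : Measurable fun x : Fin N → Θ => lik (x n) D :=
    (lik.measurable_coe hD).comp (measurable_pi_apply n)
  have hmap : (μ.restrict (y n i ⁻¹' D)).map (fun ω n => θ n ω) =
      (μ.map fun ω n => θ n ω).withDensity fun x => lik (x n) D := by
    ext A hA
    rw [Measure.map_apply hv hA, Measure.restrict_apply (hv hA), hy.measure_inter n i hD hA,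
      withDensity_apply _ hA, setLIntegral_map hA hl hv]
  rw [← lintegral_map hF hv, hmap, lintegral_withDensity_eq_lintegral_mul _ hl hF,
    lintegral_map (hl.mul hF) hv]
  rfl

open Classical in
/-- Given `θ₁, …, θ_N`, the conditional expectation of a weighted acceptance indicator is the
weighted acceptance probability. -/
lemma IsSimulatedData.integrable_and_condExp {Ω : Type*} [MeasurableSpace Ω] {μ : Measure Ω}
    [IsProbabilityMeasure μ]
    {lik : Kernel Θ Y} [IsMarkovKernel lik] {N M : ℕ} {θ : Fin N → Ω → Θ}
    (hθ : ∀ n, Measurable (θ n))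
    {y : Fin N → Fin M → Ω → Y} (hy : IsSimulatedData μ lik θ y) (n : Fin N) (i : Fin M)
    {D : Set Y} (hD : MeasurableSet D) {w : Θ → ℝ} (hw : Measurable w) (hw0 : ∀ x, 0 ≤ w x)
    (hint : Integrable (fun ω => w (θ n ω) * (lik (θ n ω)).real D) μ) :
    Integrable (fun ω => w (θ n ω) * if y n i ω ∈ D then (1 : ℝ) else 0) μ ∧
    μ[fun ω => w (θ n ω) * if y n i ω ∈ D then (1 : ℝ) else 0 | sigmaTheta θ] =ᵐ[μ]
      fun ω => w (θ n ω) * (lik (θ n ω)).real D := by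
  have hv : Measurable fun ω n => θ n ω := measurable_pi_lambda _ hθ
  have hE : MeasurableSet (y n i ⁻¹' D) := hy.measurable n i hD
  have hind : (fun ω => w (θ n ω) * if y n i ω ∈ D then (1 : ℝ) else 0) =
      (y n i ⁻¹' D).indicator fun ω => w (θ n ω) := by
    ext ω
    simp [Set.indicator_apply]
  have hwθ : Measurable fun ω => w (θ n ω) := hw.comp (hθ n)
  have hlreal : Measurable fun x => (lik x).real D := (lik.measurable_coe hD).ennreal_toReal
  have hfm : Measurable fun x => w x * (lik x).real D := hw.mul hlreal
  have hof (x : Θ) : ENNReal.ofReal (w x * (lik x).real D) = lik x D * ENNReal.ofReal (w x) := by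
    rw [ENNReal.ofReal_mul (hw0 x), mul_comm, Measure.real, ENNReal.ofReal_toReal (by finiteness)]
  -- Stated for nonnegative integrals, this needs no integrability of the indicator term: `A = univ`
  -- yields that integrability, general `A` the conditional expectation.
  have hset {A : Set (Fin N → Θ)} (hA : MeasurableSet A) :
      ∫⁻ ω in (fun ω n => θ n ω) ⁻¹' A,
        ENNReal.ofReal ((y n i ⁻¹' D).indicator (fun ω => w (θ n ω)) ω) ∂μ =
      ∫⁻ ω in (fun ω n => θ n ω) ⁻¹' A, ENNReal.ofReal (w (θ n ω) * (lik (θ n ω)).real D) ∂μ := by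
    have h := hy.setLIntegral_eq hθ n i hD
      (F := A.indicator fun x => ENNReal.ofReal (w (x n)))
      (((hw.comp (measurable_pi_apply n)).ennreal_ofReal).indicator hA)
    rw [← lintegral_indicator (hv hA), ← lintegral_indicator (hv hA)]
    rw [← lintegral_indicator hE] at h
    refine Eq.trans (lintegral_congr fun ω => ?_) (h.trans (lintegral_congr fun ω => ?_))
    · by_cases h1 : (fun n => θ n ω) ∈ A <;> by_cases h2 : y n i ω ∈ D <;>
        simp [Set.indicator_apply, h1, h2]
    · by_cases h1 : (fun n => θ n ω) ∈ A <;> simp [h1, hof]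
  have hpos (ω : Ω) : 0 ≤ (y n i ⁻¹' D).indicator (fun ω => w (θ n ω)) ω :=
    Set.indicator_nonneg (fun ω _ => hw0 (θ n ω)) ω
  have hpos' (ω : Ω) : 0 ≤ w (θ n ω) * (lik (θ n ω)).real D :=
    mul_nonneg (hw0 _) measureReal_nonneg
  have hmeas : Measurable ((y n i ⁻¹' D).indicator fun ω => w (θ n ω)) := hwθ.indicator hE
  have hinteg : Integrable ((y n i ⁻¹' D).indicator fun ω => w (θ n ω)) μ := by
    refine ⟨hmeas.aestronglyMeasurable, ?_⟩
    rw [hasFiniteIntegral_iff_ofReal (Filter.Eventually.of_forall hpos)]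
    have h := hset MeasurableSet.univ
    simp only [Set.preimage_univ, Measure.restrict_univ] at h
    rw [h]
    exact (hasFiniteIntegral_iff_ofReal (Filter.Eventually.of_forall hpos')).1 hint.2
  rw [hind]
  refine ⟨hinteg, (ae_eq_condExp_of_forall_setIntegral_eq hv.comap_le hinteg
    (fun s _ _ => hint.integrableOn) ?_ ?_).symm⟩
  · rintro s ⟨A, hA, rfl⟩ -
    rw [integral_eq_lintegral_of_nonneg_ae (Filter.Eventually.of_forall hpos')
        (hfm.comp (hθ n)).aestronglyMeasurable,
      integral_eq_lintegral_of_nonneg_ae (Filter.Eventually.of_forall hpos)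
        hmeas.aestronglyMeasurable, hset hA]
  · have h1 : Measurable[sigmaTheta θ] fun ω n => θ n ω := comap_measurable _
    have h2 : Measurable fun x : Fin N → Θ => w (x n) * (lik (x n)).real D :=
      hfm.comp (measurable_pi_apply n)
    exact (h2.comp h1).stronglyMeasurable.aestronglyMeasurable

/-- The estimator of the normalising constant is integrable, and its conditional expectation
given `θ₁, …, θ_N` is the average of the weighted acceptance probabilities. -/
lemma integrable_normConstEst_and_condExp {Ω : Type*} [MeasurableSpace Ω] {μ : Measure Ω}
    [IsProbabilityMeasure μ] {p q : Θ → ℝ} (hp : Measurable p) (hp0 : ∀ x, 0 ≤ p x)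
    (hq : Measurable q) (hq0 : ∀ x, 0 ≤ q x) {lik : Kernel Θ Y} [IsMarkovKernel lik]
    {δ : Y → Y → ℝ} {ystar : Y} {ε : ℝ} (hδ : Measurable fun y => δ y ystar) {N M : ℕ}
    (hM : 1 ≤ M) {θ : Fin N → Ω → Θ} (hθ : ∀ n, Measurable (θ n))
    {y : Fin N → Fin M → Ω → Y} (hy : IsSimulatedData μ lik θ y)
    (hint : ∀ n, Integrable (fun ω => weightedProb p q lik δ ystar ε (θ n ω)) μ) :
    Integrable (normConstEst p q δ ystar ε θ y) μ ∧
    μ[normConstEst p q δ ystar ε θ y | sigmaTheta θ] =ᵐ[μ]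
      fun ω => (1 / (N : ℝ)) * ∑ n, weightedProb p q lik δ ystar ε (θ n ω) := by
  classical
  have hD : MeasurableSet {y | δ y ystar ≤ ε} := measurableSet_le hδ measurable_const
  have hw : Measurable fun x => p x / q x := hp.div hq
  have key (n : Fin N) (i : Fin M) := hy.integrable_and_condExp hθ n i hD hw
    (fun x => div_nonneg (hp0 x) (hq0 x)) (hint n)
  set X : Fin N × Fin M → Ω → ℝ := fun s ω => p (θ s.1 ω) / q (θ s.1 ω) *
    if y s.1 s.2 ω ∈ {y | δ y ystar ≤ ε} then (1 : ℝ) else 0 with hX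
  have heq : normConstEst p q δ ystar ε θ y =
      (1 / (N : ℝ) * (1 / (M : ℝ))) • ∑ s, X s := by
    ext ω
    simp only [normConstEst, Pi.smul_apply, smul_eq_mul, Finset.sum_apply,
      Fintype.sum_prod_type, hX, Set.mem_ofPred_eq]
    rw [mul_assoc, Finset.mul_sum (a := 1 / (M : ℝ))]
    congr 1
    refine Finset.sum_congr rfl fun n _ => ?_
    rw [← Finset.mul_sum]
    ring
  have hXi : ∀ s ∈ Finset.univ, Integrable (X s) μ := fun s _ => (key s.1 s.2).1
  rw [heq]
  refine ⟨(integrable_finsetSum' _ hXi).smul _, ?_⟩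
  have h1 := condExp_smul (μ := μ) (1 / (N : ℝ) * (1 / (M : ℝ))) (∑ s, X s) (sigmaTheta θ)
  have h2 := condExp_finsetSum hXi (sigmaTheta θ)
  have h3 : ∀ᵐ ω ∂μ, ∀ s : Fin N × Fin M,
      (μ[X s | sigmaTheta θ]) ω = weightedProb p q lik δ ystar ε (θ s.1 ω) :=
    ae_all_iff.2 fun s => (key s.1 s.2).2
  have hM' : (M : ℝ) ≠ 0 := by
    have : M ≠ 0 := by omega
    exact_mod_cast this
  filter_upwards [h1, h2, h3] with ω e1 e2 e3
  rw [e1, Pi.smul_apply, e2, Finset.sum_apply, Finset.sum_congr rfl fun s _ => e3 s,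
    Fintype.sum_prod_type]
  simp only [Finset.sum_const, Finset.card_univ, Fintype.card_fin, nsmul_eq_mul, smul_eq_mul,
    ← Finset.mul_sum]
  -- All `M` replicates have the same conditional mean, so `M` cancels against `1 / M`.
  field_simp

end ABC

/-! ### The variance of the conditional expectation of the estimator -/

theorem proposition1
    -- parameter and data spaces; prior density, proposal density, model, ABC ingredients
    {Θ Y : Type*} [MeasurableSpace Θ] [MeasurableSpace Y]
    (ν : Measure Θ) (p q : Θ → ℝ) (hp : ABC.IsDensity ν p) (hq : ABC.IsDensity ν q)
    (lik : Kernel Θ Y) [IsMarkovKernel lik]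
    (δ : Y → Y → ℝ) (ystar : Y) (ε : ℝ) (hδ : Measurable fun y => δ y ystar)
    (hδ0 : ∀ y y', 0 ≤ δ y y')
    (M : ℕ) (hM : 1 ≤ M)
    -- base, dimension and quality parameter of the nets
    (b : ℕ) [NeZero b] (hb : 2 ≤ b) (d t : ℕ)
    -- if `U` is uniform on the cube, then `Γ(U)` has density `q`; and `f ∘ Γ ∈ L²`
    (Γ : (Fin d → ℝ) → Θ) (hΓ : Measurable Γ)
    (hΓq : (RQMC.cubeMeasure d).map Γ = ν.withDensity fun x => ENNReal.ofReal (q x))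
    (hf : MemLp (fun u => ABC.weightedProb p q lik δ ystar ε (Γ u)) 2 (RQMC.cubeMeasure d))
    -- for every `k`, a scrambled `(lam k, t, m k, d)`-net of `N k` points and simulated data
    (N lam m : ℕ → ℕ) (hN : Filter.Tendsto N Filter.atTop Filter.atTop)
    {Ω : ℕ → Type*} [∀ k, MeasurableSpace (Ω k)]
    (μ : ∀ k, Measure (Ω k)) [∀ k, IsProbabilityMeasure (μ k)]
    (u : ∀ k, Fin (N k) → Ω k → Fin d → ℝ)
    (hu : ∀ k, RQMC.IsScrambledNet (μ k) b (lam k) t (m k) d (u k))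
    (θ : ∀ k, Fin (N k) → Ω k → Θ) (hθ : ∀ k n ω, θ k n ω = Γ (u k n ω))
    (y : ∀ k, Fin (N k) → Fin M → Ω k → Y)
    (hy : ∀ k, ABC.IsSimulatedData (μ k) lik (θ k) (y k)) :
    (∀ k, Integrable (ABC.normConstEst p q δ ystar ε (θ k) (y k)) (μ k)) ∧
    (∀ k, MemLp ((μ k)[ABC.normConstEst p q δ ystar ε (θ k) (y k) | ABC.sigmaTheta (θ k)])
      2 (μ k)) ∧
    (fun k => Var[(μ k)[ABC.normConstEst p q δ ystar ε (θ k) (y k) | ABC.sigmaTheta (θ k)];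
      μ k]) =o[Filter.atTop] (fun k => 1 / (N k : ℝ)) := by
  have hθm (k : ℕ) (n : Fin (N k)) : Measurable (θ k n) := by
    rw [show θ k n = fun ω => Γ (u k n ω) from funext (hθ k n)]
    exact hΓ.comp ((hu k).1 n)
  -- Each single point of the net is uniform on the cube, so square integrability of `f ∘ Γ` passes
  -- to every `f(θ_n)`.
  have hmem (k : ℕ) (n : Fin (N k)) :
      MemLp (fun ω => ABC.weightedProb p q lik δ ystar ε (θ k n ω)) 2 (μ k) := by
    simp only [hθ]
    have hf' := hf
    rw [← (hu k).map_eq hb n] at hf'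
    exact hf'.comp_of_map ((hu k).1 n).aemeasurable
  have key (k : ℕ) := ABC.integrable_normConstEst_and_condExp hp.measurable hp.nonneg
    hq.measurable hq.nonneg hδ hM (hθm k) (hy k) fun n => (hmem k n).integrable one_le_two
  refine ⟨fun k => (key k).1, fun k => ?_, ?_⟩
  · exact (memLp_congr_ae (key k).2).2 ((memLp_finsetSum _ fun n _ => hmem k n).const_mul _)
  · refine (RQMC.variance_average_isLittleO hb hf hN μ hu).congr_left fun k => ?_
    rw [variance_congr (key k).2]
    simp only [hθ]
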